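/- **Setting.** For every $n$ let $m=m(n)$, $L=L(n)$ be natural numbers and $\epsilon=\epsilon(n)\ge 0$ with $m=\omega(\log n)$, $L=O(\mathrm{poly}(n))$, $\epsilon=O(2^{-m})$. Let $Q_L$ be an $[[n',n+m]]$ stabilizer code, with commuting independent Pauli generators of a stabilizer group not containing $-I$ and with a Clifford encoding unitary $C$ (encoding $|\psi\rangle\mapsto|\bar\psi\rangle=C(|\psi\rangle\otimes|0\rangle^{\otimes(n'-n-m)})$ onto the code space, so that $C^\dagger EC=P\otimes A$ with Pauli $P$, $A$ for every Pauli $E$; $P$ is the logical error of $E$). Let $\mathcal E$ be a set of $n'$-qubit Pauli errors such that $Q_L$ is $L$-list decodable for $\mathcal E$: at most $L$ stabilizer distinct errors of $\mathcal E$ (i.e. not related by an element of the stabilizer group, up to a global phase) share the syndrome of any given error of $\mathcal E$. Let $\{U_\lambda\}_\lambda$ be a finite family of $(n+m)$-qubit unitaries with uniformly random key $\lambda$ that is an exact unitary $2$-design and an approximate unitary $4$-design with relative error $\epsilon$, i.e. $(1-\epsilon)\Phi_{\rm Haar}\preceq\Phi_\lambda\preceq(1+\epsilon)\Phi_{\rm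 Haar}$ in the completely positive order, where $\Phi(X)=\mathbb E\,U^{\otimes4}XU^{\dagger\otimes4}$. **Protocol.** An $n$-qubit pure state $|\phi\rangle$ is turned into $|\psi\rangle=U_\lambda(|\phi\rangle\otimes|0\rangle^{\otimes m})$, encoded into $|\bar\psi\rangle$, and corrupted by an error $E\in\mathcal E$, where $|\phi\rangle$ and $E$ do not depend on $\lambda$. The decoding algorithm measures the syndrome $s$, undoes the encoding and discards the $n'-n-m$ ancillas, and takes the list $E_1^s,\dots,E_\ell^s$ of logical errors of representatives (in any order) of the stabilizer distinct errors of $\mathcal E$ with syndrome $s$. For $b=1,2,\dots,\ell$ it applies $U_\lambda^\dagger E_b^{s\dagger}$ and measures $\{\Pi,I-\Pi\}$ with $\Pi=I\otimes|0\rangle\langle0|^{\otimes m}$; on outcome $\Pi$ it halts and returns the post-measurement state, on outcome $I-\Pi$ it applies $E_b^sU_\lambda$ and continues. **Theorem.** Let $p(n)=\mathrm{polylog}(n)$ and $\delta=\Theta(2^{-m+p(n)})$, $\delta>0$. There are functions $\eta=\Theta(L\,2^{-m/2+p(n)/2})$, $\kappa=O\big((\epsilon+2^{-m})/\delta\big)$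 and $\nu$ of $n$, depending only on $m,L,\epsilon,p,\delta$, such that for all $n$ and all codes, encoders, error sets, lists, unitary families, $|\phi\rangle$ and $E\in\mathcal E$ as above, with probability at least $1-\kappa$ over the keys $\lambda$ the following holds: with probability at least $1-\nu$ over the measurement randomness, the algorithm returns a state whose (Uhlmann) fidelity with $|\phi\rangle\langle\phi|\otimes|0\rangle\langle0|^{\otimes m}$ is at least $1-\eta$. Moreover, if $m-p(n)=\omega(\log n)$ (so that $\delta$ is negligible), then $\eta$ and $\nu$ are negligible; if $p(n)=\omega(\log n)$ (so that $2^{-m}/\delta$ is negligible), then $\kappa$ is negligible. For every $m=\omega(\log n)$ there is a polylogarithmic $p$ that satisfies both conditions. -/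

import Mathlib

open Filter Topology Asymptotics MeasureTheory
open scoped Matrix Kronecker MatrixOrder ComplexOrder

noncomputable section

/-! ### Negligible functions, logarithmic growth -/

/-- A nonnegative function that is eventually smaller than every inverse power of `n`. -/
def Negligible (f : ℕ → ℝ) : Prop :=
  (∀ n, 0 ≤ f n) ∧ ∀ c : ℕ, ∃ n₀ : ℕ, ∀ n > n₀, f n < ((n : ℝ) ^ c)⁻¹

/-- `f = ω(log n)`. -/
def SuperLog (f : ℕ → ℝ) : Prop :=
  Tendsto (fun n : ℕ => f n / Real.log (n : ℝ)) atTop atTop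

/-- `f = polylog(n)`, that is `f = O((log n)^c)` for some `c`. -/
def Polylog (f : ℕ → ℝ) : Prop :=
  ∃ c : ℕ, f =O[atTop] fun n : ℕ => Real.log (n : ℝ) ^ c

/-! ### Qubits, states, Pauli operators -/

/-- The computational basis labels of a register of `k` qubits; a state vector of the register is
a function `Qubits k → ℂ`, an operator is a matrix indexed by `Qubits k`. -/
abbrev Qubits (k : ℕ) : Type := Fin k → Fin 2

/-- The basis label `0…0`. -/
def zeroLabel (k : ℕ) : Qubits k := fun _ => 0

/-- The operator `|ψ⟩⟨ψ|`. -/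
def pureState {ι : Type} (ψ : ι → ℂ) : Matrix ι ι ℂ := Matrix.vecMulVec ψ (star ψ)

/-- Uhlmann fidelity `(Tr √(√σ ρ √σ))²`. -/
def fidelity {ι : Type} [Fintype ι] [DecidableEq ι] (ρ σ : Matrix ι ι ℂ) : ℝ :=
  (CFC.sqrt (CFC.sqrt σ * ρ * CFC.sqrt σ)).trace.re ^ 2

/-- The single-qubit Pauli matrices `I, X, Y, Z`. -/
def pauliOne : Fin 4 → Matrix (Fin 2) (Fin 2) ℂ :=
  ![1, !![0, 1; 1, 0], !![0, -Complex.I; Complex.I, 0], !![1, 0; 0, -1]]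

/-- The tensor product of single-qubit Pauli matrices. -/
def pauliString {k : ℕ} (P : Fin k → Fin 4) : Matrix (Qubits k) (Qubits k) ℂ :=
  Matrix.of fun a b => ∏ i, pauliOne (P i) (a i) (b i)

/-- Membership in the `k`-qubit Pauli group (with the phases `±1, ±i`). -/
def IsPauli {k : ℕ} (E : Matrix (Qubits k) (Qubits k) ℂ) : Prop :=
  ∃ (c : ℕ) (P : Fin k → Fin 4), E = Complex.I ^ c • pauliString P

/-! ### Stabilizer codes and quantum list decoding -/

/-- An `[[N, k]]` stabilizer code, given by `N - k` independent commuting Pauli generators of a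
group that does not contain `-1`. -/
structure StabilizerCode (N k : ℕ) where
  le : k ≤ N
  gen : Fin (N - k) → Matrix (Qubits N) (Qubits N) ℂ
  isPauli : ∀ i, IsPauli (gen i)
  comm : ∀ i j, gen i * gen j = gen j * gen i
  neg_one_notMem : (-1 : Matrix (Qubits N) (Qubits N) ℂ) ∉ Submonoid.closure (Set.range gen)
  indep : ∀ i, gen i ∉ Submonoid.closure (gen '' {j | j ≠ i})

namespace StabilizerCode

variable {N k : ℕ} (Q : StabilizerCode N k)

/-- The stabilizer group (the generators square to `1`, so the monoid they generate is a group). -/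
def stabilizer : Submonoid (Matrix (Qubits N) (Qubits N) ℂ) :=
  Submonoid.closure (Set.range Q.gen)

/-- Membership in the code space. -/
def InCodeSpace (v : Qubits N → ℂ) : Prop := ∀ g ∈ Q.stabilizer, g *ᵥ v = v

/-- A syndrome: one measurement outcome for each generator (outcome `x` stands for `(-1)^x`). -/
abbrev Syndrome (_ : StabilizerCode N k) : Type := Fin (N - k) → Fin 2

/-- The error `E` has syndrome `s`. -/
def HasSyndrome (E : Matrix (Qubits N) (Qubits N) ℂ) (s : Q.Syndrome) : Prop :=
  ∀ i, Q.gen i * E = (-1 : ℂ) ^ (s i : ℕ) • (E * Q.gen i)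

/-- The projector onto the joint eigenspace of the generators that belongs to the outcome `s` of
the syndrome measurement. -/
def syndromeProj (s : Q.Syndrome) : Matrix (Qubits N) (Qubits N) ℂ :=
  (List.ofFn fun i => (2 : ℂ)⁻¹ • (1 + (-1 : ℂ) ^ (s i : ℕ) • Q.gen i)).prod

/-- Two errors are stabilizer equivalent if they differ by an element of the stabilizer group (and
a global phase, which does not affect any state). Otherwise they are stabilizer distinct. -/
def StabEquiv (E F : Matrix (Qubits N) (Qubits N) ℂ) : Prop :=
  ∃ g ∈ Q.stabilizer, ∃ c : ℂ, ‖c‖ = 1 ∧ F = c • (E * g)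

/-- The code is `L`-list decodable for the error set `ℰ`: at most `L` stabilizer distinct errors
of `ℰ` share the syndrome of an error of `ℰ`. -/
def IsListDecodable (ℰ : Set (Matrix (Qubits N) (Qubits N) ℂ)) (L : ℕ) : Prop :=
  ∀ E ∈ ℰ, ∀ s, Q.HasSyndrome E s → ∀ T : Finset (Matrix (Qubits N) (Qubits N) ℂ),
    (∀ F ∈ T, F ∈ ℰ ∧ Q.HasSyndrome F s) →
    (∀ F ∈ T, ∀ G ∈ T, F ≠ G → ¬ Q.StabEquiv F G) → T.card ≤ L

/-- The state `C (|ψ⟩ ⊗ |0…0⟩)`. -/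
def encode (C : Matrix (Qubits N) (Qubits k × Qubits (N - k)) ℂ) (ψ : Qubits k → ℂ) :
    Qubits N → ℂ :=
  C *ᵥ fun a => if a.2 = zeroLabel (N - k) then ψ a.1 else 0

/-- `C` is a Clifford unitary (it maps Pauli operators to Pauli operators by conjugation, in both
directions) that encodes the logical register, next to ancillas in the state `|0…0⟩`, onto the
code space. -/
structure IsCliffordEncoder (C : Matrix (Qubits N) (Qubits k × Qubits (N - k)) ℂ) : Prop where
  isometry : Cᴴ * C = 1
  coisometry : C * Cᴴ = 1
  pauli_left : ∀ E : Matrix (Qubits N) (Qubits N) ℂ, IsPauli E → ∃ (P : Matrix (Qubits k) (Qubits k) ℂ)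
    (A : Matrix (Qubits (N - k)) (Qubits (N - k)) ℂ),
    IsPauli P ∧ IsPauli A ∧ Cᴴ * E * C = P ⊗ₖ A
  pauli_right : ∀ (P : Matrix (Qubits k) (Qubits k) ℂ)
    (A : Matrix (Qubits (N - k)) (Qubits (N - k)) ℂ),
    IsPauli P → IsPauli A → IsPauli (C * (P ⊗ₖ A) * Cᴴ)
  range : ∀ v, Q.InCodeSpace v ↔ ∃ ψ, v = encode C ψ

/-- Undo the encoding and trace out the ancillas. -/
def unencode (C : Matrix (Qubits N) (Qubits k × Qubits (N - k)) ℂ)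
    (ρ : Matrix (Qubits N) (Qubits N) ℂ) : Matrix (Qubits k) (Qubits k) ℂ :=
  Matrix.of fun a b => ∑ x, (Cᴴ * ρ * C) (a, x) (b, x)

/-- `l` lists, in some order, one representative of each class of stabilizer equivalent errors
of `ℰ` with syndrome `s`. -/
def IsErrorList (ℰ : Set (Matrix (Qubits N) (Qubits N) ℂ)) (s : Q.Syndrome)
    (l : List (Matrix (Qubits N) (Qubits N) ℂ)) : Prop :=
  (∀ E ∈ l, E ∈ ℰ ∧ Q.HasSyndrome E s) ∧
  l.Pairwise (fun E F => ¬ Q.StabEquiv E F) ∧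
  ∀ F ∈ ℰ, Q.HasSyndrome F s → ∃ E ∈ l, Q.StabEquiv E F

/-- `P` is the logical error of the physical error `E`: `C† E C = P ⊗ A`. -/
def IsLogicalError (C : Matrix (Qubits N) (Qubits k × Qubits (N - k)) ℂ)
    (E : Matrix (Qubits N) (Qubits N) ℂ) (P : Matrix (Qubits k) (Qubits k) ℂ) : Prop :=
  IsPauli P ∧ ∃ A : Matrix (Qubits (N - k)) (Qubits (N - k)) ℂ,
    IsPauli A ∧ Cᴴ * E * C = P ⊗ₖ A

/-- A list decoder: it assigns to each syndrome the list of the logical errors that belong to the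
list of physical errors of `ℰ` with that syndrome. -/
def IsListDecoder (C : Matrix (Qubits N) (Qubits k × Qubits (N - k)) ℂ)
    (ℰ : Set (Matrix (Qubits N) (Qubits N) ℂ))
    (dec : Q.Syndrome → List (Matrix (Qubits k) (Qubits k) ℂ)) : Prop :=
  ∀ s, ∃ l, Q.IsErrorList ℰ s l ∧ List.Forall₂ (IsLogicalError C) l (dec s)

end StabilizerCode

/-! ### The decoding algorithm -/

/-- The state `|φ⟩|0…0⟩` of `n` message qubits and `m` tag qubits. -/
def addTag {n : ℕ} (m : ℕ) (φ : Qubits n → ℂ) : Qubits (n + m) → ℂ :=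
  fun a => if (fun j => a (Fin.natAdd n j)) = zeroLabel m then φ (fun i => a (Fin.castAdd m i))
    else 0

/-- The tag projector `I ⊗ |0…0⟩⟨0…0|`. -/
def tagProj (n m : ℕ) : Matrix (Qubits (n + m)) (Qubits (n + m)) ℂ :=
  Matrix.diagonal fun a => if (fun j => a (Fin.natAdd n j)) = zeroLabel m then 1 else 0

/-- The loop of the algorithm with unitary `U` and test projector `T`, run on the (unnormalised) state `σ` with the remaining list of
logical errors. It returns the unnormalised output states of the branches in which the search halts
at the first, second, … element of the list: the trace of such a matrix is the probability of the
branch, and the matrix divided by its trace is the state that is returned. -/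
def searchLoop {ι : Type} [Fintype ι] [DecidableEq ι] (U T : Matrix ι ι ℂ) :
    List (Matrix ι ι ℂ) → Matrix ι ι ℂ → List (Matrix ι ι ℂ)
  | [], _ => []
  | E :: l, σ =>
    let τ := Uᴴ * Eᴴ * σ * E * U
    (T * τ * T) :: searchLoop U T l (E * U * ((1 - T) * τ * (1 - T)) * Uᴴ * Eᴴ)

/-- The whole algorithm on the input `ρ`: measure the syndrome, undo the encoding, search through
the list of the measured syndrome `s`. The value at `s` is the list of the unnormalised output
states of the branches with measured syndrome `s`. -/
def runAlgorithm {N n m : ℕ} (Q : StabilizerCode N (n + m))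
    (C : Matrix (Qubits N) (Qubits (n + m) × Qubits (N - (n + m))) ℂ)
    (dec : Q.Syndrome → List (Matrix (Qubits (n + m)) (Qubits (n + m)) ℂ))
    (U : Matrix (Qubits (n + m)) (Qubits (n + m)) ℂ) (ρ : Matrix (Qubits N) (Qubits N) ℂ)
    (s : Q.Syndrome) : List (Matrix (Qubits (n + m)) (Qubits (n + m)) ℂ) :=
  searchLoop U (tagProj n m) (dec s)
    (StabilizerCode.unencode C (Q.syndromeProj s * ρ * Q.syndromeProj s))

open Classical in
/-- The probability, over all measurement outcomes of the algorithm, that the algorithm returns a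
state whose fidelity with `target` is at least `f`. -/
def successProb {N n m : ℕ} (Q : StabilizerCode N (n + m))
    (C : Matrix (Qubits N) (Qubits (n + m) × Qubits (N - (n + m))) ℂ)
    (dec : Q.Syndrome → List (Matrix (Qubits (n + m)) (Qubits (n + m)) ℂ))
    (U : Matrix (Qubits (n + m)) (Qubits (n + m)) ℂ) (ρ : Matrix (Qubits N) (Qubits N) ℂ)
    (target : Matrix (Qubits (n + m)) (Qubits (n + m)) ℂ) (f : ℝ) : ℝ :=
  ∑ s, ((runAlgorithm Q C dec U ρ s).map fun ω =>
    if f ≤ fidelity (ω.trace⁻¹ • ω) target then ω.trace.re else 0).sum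

/-! ### Unitary designs -/

section Haar

variable {ι : Type} [Fintype ι] [DecidableEq ι]

instance instMeasurableSpaceUnitaryGroupComplex : MeasurableSpace (Matrix.unitaryGroup ι ℂ) :=
  borel _

instance instBorelSpaceUnitaryGroupComplex : BorelSpace (Matrix.unitaryGroup ι ℂ) := ⟨rfl⟩

instance instCompactSpaceUnitaryGroupComplex : CompactSpace (Matrix.unitaryGroup ι ℂ) := by
  refine isCompact_iff_compactSpace.mp ?_
  have hK : IsCompact (Set.pi Set.univ fun _ : ι => Set.pi Set.univ fun _ : ι =>
      Metric.closedBall (0 : ℂ) 1) :=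
    isCompact_univ_pi fun _ => isCompact_univ_pi fun _ => isCompact_closedBall _ _
  refine IsCompact.of_isClosed_subset (s := (show Set (Matrix ι ι ℂ) from Set.pi Set.univ fun _ : ι => Set.pi Set.univ fun _ : ι =>
      Metric.closedBall (0 : ℂ) 1)) hK (isClosed_unitary (R := Matrix ι ι ℂ)) ?_
  intro U hU i _ j _
  simpa using entry_norm_bound_of_unitary hU i j

/-- The Haar probability measure on the unitary group. -/
def unitaryHaar (ι : Type) [Fintype ι] [DecidableEq ι] : Measure (Matrix.unitaryGroup ι ℂ) :=
  Measure.haarMeasure ⊤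

/-- The `t`-fold tensor power of a matrix. -/
def tensorPow (t : ℕ) (A : Matrix ι ι ℂ) : Matrix (Fin t → ι) (Fin t → ι) ℂ :=
  Matrix.of fun a b => ∏ i, A (a i) (b i)

/-- `V^{⊗t} X V^{†⊗t}`. -/
def conjTensor (t : ℕ) (V : Matrix.unitaryGroup ι ℂ)
    (X : Matrix (Fin t → ι) (Fin t → ι) ℂ) : Matrix (Fin t → ι) (Fin t → ι) ℂ :=
  tensorPow t (V : Matrix ι ι ℂ) * X * (tensorPow t (V : Matrix ι ι ℂ))ᴴ

/-- The `t`-fold twirl over the Haar measure (the average is taken entrywise). -/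
def haarTwirl (t : ℕ) (X : Matrix (Fin t → ι) (Fin t → ι) ℂ) :
    Matrix (Fin t → ι) (Fin t → ι) ℂ :=
  Matrix.of fun a b => ∫ V, conjTensor t V X a b ∂(unitaryHaar ι)

/-- The `t`-fold twirl over a finite keyed family of unitaries with uniformly random key. -/
def keyTwirl {K : Type} [Fintype K] (U : K → Matrix.unitaryGroup ι ℂ) (t : ℕ)
    (X : Matrix (Fin t → ι) (Fin t → ι) ℂ) : Matrix (Fin t → ι) (Fin t → ι) ℂ :=
  (Fintype.card K : ℂ)⁻¹ • ∑ key, conjTensor t (U key) X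

/-- The keyed family is an exact unitary `t`-design. -/
def IsExactDesign {K : Type} [Fintype K] (t : ℕ) (U : K → Matrix.unitaryGroup ι ℂ) : Prop :=
  ∀ X, keyTwirl U t X = haarTwirl t X

/-- Complete positivity of a (linear) map on matrices. -/
def IsCompletelyPositive {κ : Type} [Fintype κ] (Φ : Matrix κ κ ℂ → Matrix κ κ ℂ) : Prop :=
  ∀ (r : ℕ) (X : Matrix (Fin r × κ) (Fin r × κ) ℂ), X.PosSemidef →
    (Matrix.of fun a b : Fin r × κ =>
      Φ (Matrix.of fun i j => X (a.1, i) (b.1, j)) a.2 b.2).PosSemidef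

/-- The keyed family is an approximate unitary `t`-design with relative error `ε`:
`(1 - ε) Φ_Haar ⪯ Φ_U ⪯ (1 + ε) Φ_Haar` for the `t`-fold twirls, in the order in which `Φ ⪯ Ψ` means
that `Ψ - Φ` is completely positive. -/
def IsRelativeErrorDesign {K : Type} [Fintype K] (t : ℕ) (ε : ℝ)
    (U : K → Matrix.unitaryGroup ι ℂ) : Prop :=
  IsCompletelyPositive (fun X => keyTwirl U t X - (1 - ε) • haarTwirl t X) ∧
  IsCompletelyPositive (fun X => (1 + ε) • haarTwirl t X - keyTwirl U t X)

end Haar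

/-- The probability of an event over a uniformly random key. -/
def keyProb (K : Type) (p : K → Prop) : ℝ := (Nat.card {key // p key} : ℝ) / Nat.card K

end

/-! Let `P` be the logical error that occurred and `v = P U |φ,0⟩` the state that enters the search.
A test of a wrong entry `B` succeeds on `v` with probability `‖T U† (B†P) U |φ,0⟩‖²`, where `T` is
the tag projector. The proof bounds this probability on average over the keys and shows that
unlikely test successes barely disturb the state.

Algebra of the code: two errors with the same syndrome whose logical errors agree up to a phase act
on the code space as multiples of each other, and a Pauli operator that is scalar on the code space
is a phase times a stabilizer. So for stabilizer distinct errors `B†P` is a traceless Pauli operator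
(`trace_eq_zero_of_not_stabEquiv`).

Average: the success probability is a linear function of a two-copy twirl, so an exact 2-design
gives its Haar mean `g(F)`, `F = B†P`. No Weingarten calculus is needed. If the Pauli string `R`
anticommutes with `F`, a unitary carries `F` to `R`, so `g(R) = g(F)`. Half of the `4^k` strings
anticommute with `F`, and all values of `g` are nonnegative with sum `2^k Tr T` by the Pauli twirl.
Hence `g(F) ≤ 2 Tr T / 2^k = 2 · 2^(-m)` for `k = n + m` (`integral_overlap_le`).

Concentration and gentleness: fewer than `L` wrong entries precede `P`. By Markov the sum of their
success probabilities is at most `L δ`, except for a fraction `2 · 2^(-m) / δ` of the keys; the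
factor `L` cancels. The sum of the amplitudes is then at most `β = L √δ`. Failed tests are
projections, so the deviations from `v` add up to at most `β` (`vnorm_sub_afterFailures_le`). The
branch that halts at `P` alone therefore has probability and fidelity at least `(1 - β)² ≥ 1 - 2β`,
whence `η = ν = 2 L √δ` and `κ = 2 · 2^(-m) / δ`. -/

/-! ### Pauli operators -/

/-- The tensor product of operators on the factors. -/
def piTensor {ι : Type} {k : ℕ} (A : Fin k → Matrix ι ι ℂ) : Matrix (Fin k → ι) (Fin k → ι) ℂ :=
  Matrix.of fun a b => ∏ i, A i (a i) (b i)

theorem pauliString_eq_piTensor {k : ℕ} (P : Fin k → Fin 4) :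
    pauliString P = piTensor fun i => pauliOne (P i) := rfl

theorem piTensor_mul {ι : Type} [Fintype ι] {k : ℕ} (A B : Fin k → Matrix ι ι ℂ) :
    piTensor A * piTensor B = piTensor fun i => A i * B i := by
  ext a b
  simp only [piTensor, Matrix.mul_apply, Matrix.of_apply, ← Finset.prod_mul_distrib]
  rw [Finset.prod_univ_sum, Fintype.piFinset_univ]

theorem piTensor_smul {ι : Type} {k : ℕ} (c : Fin k → ℂ) (A : Fin k → Matrix ι ι ℂ) :
    (piTensor fun i => c i • A i) = (∏ i, c i) • piTensor A := by
  ext a b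
  simp [piTensor, Finset.prod_mul_distrib]

theorem piTensor_one {ι : Type} [DecidableEq ι] {k : ℕ} :
    (piTensor fun _ : Fin k => (1 : Matrix ι ι ℂ)) = 1 := by
  ext a b
  simp only [piTensor, Matrix.of_apply, Matrix.one_apply, Finset.prod_ite_zero,
    Finset.prod_const_one]
  simp [funext_iff]

theorem piTensor_conjTranspose {ι : Type} {k : ℕ} (A : Fin k → Matrix ι ι ℂ) :
    (piTensor A)ᴴ = piTensor fun i => (A i)ᴴ := by
  ext a b
  simp [piTensor, Matrix.conjTranspose_apply]

theorem trace_piTensor {ι : Type} [Fintype ι] {k : ℕ} (A : Fin k → Matrix ι ι ℂ) :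
    (piTensor A).trace = ∏ i, (A i).trace := by
  simp only [Matrix.trace, Matrix.diag, piTensor, Matrix.of_apply]
  rw [Finset.prod_univ_sum, Fintype.piFinset_univ]

theorem pauliOne_conjTranspose (p : Fin 4) : (pauliOne p)ᴴ = pauliOne p := by
  fin_cases p <;> ext i j <;> fin_cases i <;> fin_cases j <;>
    simp [pauliOne, Matrix.conjTranspose_apply]

theorem pauliOne_mul_self (p : Fin 4) : pauliOne p * pauliOne p = 1 := by
  fin_cases p <;> ext i j <;> fin_cases i <;> fin_cases j <;>
    simp [pauliOne, Matrix.mul_apply]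

theorem pauliOne_trace {p : Fin 4} (hp : p ≠ 0) : (pauliOne p).trace = 0 := by
  fin_cases p <;> simp_all [pauliOne, Matrix.trace]

theorem pauliOne_mul (p q : Fin 4) :
    ∃ (c : ℕ) (r : Fin 4), pauliOne p * pauliOne q = Complex.I ^ c • pauliOne r := by
  have hI3 : Complex.I ^ 3 = -Complex.I := by
    rw [pow_succ, Complex.I_sq]; ring
  -- The first table holds the exponents of the phase `i`, the second the product in the Klein
  -- four-group `{I, X, Y, Z}`.
  have key : ∀ p q : Fin 4, pauliOne p * pauliOne q =
      Complex.I ^ ((![![0, 0, 0, 0], ![0, 0, 1, 3], ![0, 3, 0, 1], ![0, 1, 3, 0]] :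
        Fin 4 → Fin 4 → ℕ) p q) •
      pauliOne ((![![0, 1, 2, 3], ![1, 0, 3, 2], ![2, 3, 0, 1], ![3, 2, 1, 0]] :
        Fin 4 → Fin 4 → Fin 4) p q) := by
    intro p q
    fin_cases p <;> fin_cases q <;> ext i j <;> fin_cases i <;> fin_cases j <;>
      simp [pauliOne, Matrix.mul_apply, hI3]
  exact ⟨_, _, key p q⟩

theorem pauliOne_comm (p q : Fin 4) :
    ∃ c : ℤˣ, pauliOne p * pauliOne q = ((c : ℤ) : ℂ) • (pauliOne q * pauliOne p) := by
  have key : ∀ p q : Fin 4, pauliOne p * pauliOne q =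
      (((if p = 0 ∨ q = 0 ∨ p = q then 1 else -1 : ℤˣ) : ℤ) : ℂ) •
        (pauliOne q * pauliOne p) := by
    intro p q
    fin_cases p <;> fin_cases q <;> ext i j <;> fin_cases i <;> fin_cases j <;>
      simp [pauliOne, Matrix.mul_apply]
  exact ⟨_, key p q⟩

/-- Completeness of the Pauli basis: the sum of `p ⊗ p` is twice the swap operator. -/
theorem sum_pauliOne (a b c d : Fin 2) :
    ∑ p, pauliOne p a b * pauliOne p c d = if a = d ∧ b = c then 2 else 0 := by
  fin_cases a <;> fin_cases b <;> fin_cases c <;> fin_cases d <;>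
    simp [Fin.sum_univ_four, pauliOne] <;> norm_num

section PauliString

variable {k : ℕ}

theorem pauliString_conjTranspose (P : Fin k → Fin 4) : (pauliString P)ᴴ = pauliString P := by
  simp [pauliString_eq_piTensor, piTensor_conjTranspose, pauliOne_conjTranspose]

theorem pauliString_mul_self (P : Fin k → Fin 4) : pauliString P * pauliString P = 1 := by
  simp [pauliString_eq_piTensor, piTensor_mul, pauliOne_mul_self, piTensor_one]

theorem pauliString_mul (P Q : Fin k → Fin 4) :
    ∃ (c : ℕ) (R : Fin k → Fin 4),
      pauliString P * pauliString Q = Complex.I ^ c • pauliString R := by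
  choose c r h using pauliOne_mul
  refine ⟨∑ i, c (P i) (Q i), fun i => r (P i) (Q i), ?_⟩
  simp only [pauliString_eq_piTensor, piTensor_mul, h, piTensor_smul, Finset.prod_pow_eq_pow_sum]

theorem pauliString_comm (P Q : Fin k → Fin 4) :
    ∃ c : ℤˣ, pauliString P * pauliString Q = ((c : ℤ) : ℂ) • (pauliString Q * pauliString P) := by
  choose c h using pauliOne_comm
  refine ⟨∏ i, c (P i) (Q i), ?_⟩
  simp only [pauliString_eq_piTensor, piTensor_mul]
  rw [show (fun i => pauliOne (P i) * pauliOne (Q i)) =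
    fun i => (((c (P i) (Q i) : ℤˣ) : ℤ) : ℂ) • (pauliOne (Q i) * pauliOne (P i)) from
      funext fun i => h _ _, piTensor_smul]
  simp

theorem pauliString_zero : pauliString (fun _ : Fin k => 0) = 1 := by
  rw [pauliString_eq_piTensor, ← piTensor_one]
  rfl

theorem trace_pauliString {P : Fin k → Fin 4} (hP : P ≠ fun _ => 0) : (pauliString P).trace = 0 := by
  obtain ⟨i, hi⟩ := Function.ne_iff.mp hP
  rw [pauliString_eq_piTensor, trace_piTensor]
  exact Finset.prod_eq_zero (Finset.mem_univ i) (pauliOne_trace hi)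

theorem sum_pauliString (a b c d : Qubits k) :
    ∑ P, pauliString P a b * pauliString P c d = if a = d ∧ b = c then 2 ^ k else 0 := by
  simp only [pauliString, Matrix.of_apply, ← Finset.prod_mul_distrib]
  rw [← Fintype.piFinset_univ, ← Finset.prod_univ_sum (fun _ => Finset.univ)
    (fun i p => pauliOne p (a i) (b i) * pauliOne p (c i) (d i))]
  simp only [sum_pauliOne, Finset.prod_ite_zero, Finset.prod_const, Finset.card_univ,
    Fintype.card_fin]
  simp [funext_iff, forall_and]

/-- The Pauli twirl depolarizes completely. It serves twice: to count anticommuting strings and to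
sum the overlaps over all strings. -/
theorem sum_pauliString_conj (A : Matrix (Qubits k) (Qubits k) ℂ) :
    ∑ P, pauliString P * A * pauliString P = (2 ^ k * A.trace) • 1 := by
  ext a d
  simp only [Matrix.sum_apply, Matrix.mul_apply, Finset.sum_mul]
  rw [Finset.sum_comm]
  simp_rw [Finset.sum_comm (γ := Fin k → Fin 4)]
  have h : ∀ c b : Qubits k, ∑ P, pauliString P a b * A b c * pauliString P c d =
      if a = d ∧ b = c then 2 ^ k * A b c else 0 := by
    intro c b
    have := sum_pauliString a b c d
    calc _ = A b c * ∑ P, pauliString P a b * pauliString P c d := by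
          rw [Finset.mul_sum]; exact Finset.sum_congr rfl fun _ _ => by ring
      _ = _ := by rw [this]; split_ifs <;> ring
  simp_rw [h]
  by_cases had : a = d
  · simp [had, Matrix.trace, Finset.mul_sum]
  · simp [had]

namespace IsPauli

variable {E F : Matrix (Qubits k) (Qubits k) ℂ}

theorem one : IsPauli (1 : Matrix (Qubits k) (Qubits k) ℂ) :=
  ⟨0, fun _ => 0, by simp [pauliString_zero]⟩

theorem mul (hE : IsPauli E) (hF : IsPauli F) : IsPauli (E * F) := by
  obtain ⟨c, P, rfl⟩ := hE
  obtain ⟨d, Q, rfl⟩ := hF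
  obtain ⟨e, R, h⟩ := pauliString_mul P Q
  exact ⟨c + d + e, R, by simp [h, smul_smul, pow_add, mul_assoc, mul_left_comm]⟩

theorem conjTranspose (hE : IsPauli E) : IsPauli Eᴴ := by
  obtain ⟨c, P, rfl⟩ := hE
  -- The conjugate of `i` is `i ^ 3`.
  refine ⟨3 * c, P, ?_⟩
  rw [Matrix.conjTranspose_smul, pauliString_conjTranspose, star_pow, pow_mul]
  congr 2
  rw [pow_succ, Complex.I_sq]
  simp

theorem conjTranspose_mul_self (hE : IsPauli E) : Eᴴ * E = 1 := by
  obtain ⟨c, P, rfl⟩ := hE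
  simp [pauliString_conjTranspose, pauliString_mul_self, smul_smul, ← mul_pow]

theorem mul_conjTranspose_self (hE : IsPauli E) : E * Eᴴ = 1 := by
  obtain ⟨c, P, rfl⟩ := hE
  simp [pauliString_conjTranspose, pauliString_mul_self, smul_smul, ← mul_pow]

theorem comm (hE : IsPauli E) (hF : IsPauli F) :
    ∃ c : ℤˣ, E * F = ((c : ℤ) : ℂ) • (F * E) := by
  obtain ⟨c, P, rfl⟩ := hE
  obtain ⟨d, Q, rfl⟩ := hF
  obtain ⟨e, h⟩ := pauliString_comm P Q
  refine ⟨e, ?_⟩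
  simp only [smul_mul_smul_comm, h, smul_smul]
  congr 1
  ring

/-- Every string other than the identity is traceless, so the trace decides whether a Pauli operator
is trivial. -/
theorem eq_smul_one_of_trace_ne_zero (hE : IsPauli E) (h : E.trace ≠ 0) :
    ∃ c : ℂ, ‖c‖ = 1 ∧ E = c • 1 := by
  obtain ⟨c, P, rfl⟩ := hE
  refine ⟨Complex.I ^ c, by simp, ?_⟩
  by_cases hP : P = fun _ => 0
  · rw [hP, pauliString_zero]
  · exact absurd (by simp [trace_pauliString hP]) h

end IsPauli

end PauliString

/-! ### Rank-one operators and product vectors -/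

theorem mul_pureState_mul {ι κ : Type} [Fintype ι] (A : Matrix κ ι ℂ) (v : ι → ℂ) :
    A * pureState v * Aᴴ = pureState (A *ᵥ v) := by
  rw [pureState, pureState, Matrix.mul_vecMulVec, Matrix.vecMulVec_mul, Matrix.star_mulVec]

theorem pureState_smul {ι : Type} (c : ℂ) (v : ι → ℂ) :
    pureState (c • v) = (star c * c) • pureState v := by
  ext a b
  simp [pureState, Matrix.vecMulVec_apply]
  ring

theorem mulVec_dotProduct_mulVec {ι κ : Type} [Fintype ι] [Fintype κ] (A B : Matrix κ ι ℂ)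
    (v w : ι → ℂ) : star (A *ᵥ v) ⬝ᵥ (B *ᵥ w) = star v ⬝ᵥ ((Aᴴ * B) *ᵥ w) := by
  rw [Matrix.star_mulVec, Matrix.dotProduct_mulVec, Matrix.vecMul_vecMul, Matrix.dotProduct_mulVec]

/-- The product vector `v ⊗ w`. -/
def prodVec {α β : Type} (v : α → ℂ) (w : β → ℂ) : α × β → ℂ := fun a => v a.1 * w a.2

theorem kronecker_mulVec_prodVec {α β : Type} [Fintype α] [Fintype β] (A : Matrix α α ℂ)
    (B : Matrix β β ℂ) (v : α → ℂ) (w : β → ℂ) :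
    (A ⊗ₖ B) *ᵥ prodVec v w = prodVec (A *ᵥ v) (B *ᵥ w) := by
  ext ⟨a, b⟩
  simp only [Matrix.mulVec, dotProduct, prodVec, Matrix.kroneckerMap_apply,
    Fintype.sum_prod_type, Finset.sum_mul_sum]
  exact Finset.sum_congr rfl fun _ _ => Finset.sum_congr rfl fun _ _ => by ring

/-- The vector `|0…0⟩`. -/
def zeroKet (k : ℕ) : Qubits k → ℂ := fun x => if x = zeroLabel k then 1 else 0

theorem dotProduct_zeroKet (k : ℕ) : star (zeroKet k) ⬝ᵥ zeroKet k = 1 := by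
  simp [zeroKet, dotProduct]

theorem list_ofFn_prod_mulVec {ι : Type} [Fintype ι] [DecidableEq ι] :
    ∀ {r : ℕ} (A : Fin r → Matrix ι ι ℂ) (c : Fin r → ℂ) (v : ι → ℂ),
      (∀ i, A i *ᵥ v = c i • v) → (List.ofFn A).prod *ᵥ v = (∏ i, c i) • v
  | 0, _, _, v, _ => by simp
  | r + 1, A, c, v, h => by
    rw [List.ofFn_succ, List.prod_cons, ← Matrix.mulVec_mulVec,
      list_ofFn_prod_mulVec (fun i => A i.succ) (fun i => c i.succ) v fun i => h _,
      Matrix.mulVec_smul, h, smul_smul, Fin.prod_univ_succ, mul_comm]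

/-! ### Stabilizer group, syndrome projectors and code space -/

namespace StabilizerCode

variable {N k : ℕ} (Q : StabilizerCode N k)

theorem gen_mem (i) : Q.gen i ∈ Q.stabilizer := Submonoid.subset_closure ⟨i, rfl⟩

theorem isPauli_of_mem {g} (hg : g ∈ Q.stabilizer) : IsPauli g := by
  induction hg using Submonoid.closure_induction with
  | mem x hx => obtain ⟨i, rfl⟩ := hx; exact Q.isPauli i
  | one => exact IsPauli.one
  | mul x y _ _ hx hy => exact hx.mul hy

theorem gen_commute_of_mem (i) {g} (hg : g ∈ Q.stabilizer) : Commute (Q.gen i) g := by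
  induction hg using Submonoid.closure_induction with
  | mem x hx => obtain ⟨j, rfl⟩ := hx; exact Q.comm i j
  | one => exact Commute.one_right _
  | mul x y _ _ hx hy => exact hx.mul_right hy

theorem commute_of_mem {g h} (hg : g ∈ Q.stabilizer) (hh : h ∈ Q.stabilizer) : Commute g h := by
  induction hg using Submonoid.closure_induction with
  | mem x hx => obtain ⟨j, rfl⟩ := hx; exact Q.gen_commute_of_mem j hh
  | one => exact Commute.one_left _
  | mul x y _ _ hx hy => exact hx.mul_left hy

/-- A Pauli operator squares to `1` or `-1`, and `-1` is excluded from the group. -/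
theorem gen_mul_self (i) : Q.gen i * Q.gen i = 1 := by
  obtain ⟨c, P, h⟩ := Q.isPauli i
  have h2 : Q.gen i * Q.gen i = ((-1 : ℂ) ^ c) • 1 := by
    rw [h, smul_mul_smul_comm, pauliString_mul_self, ← mul_pow, Complex.I_mul_I]
  rcases neg_one_pow_eq_or ℂ c with hc | hc
  · rw [h2, hc, one_smul]
  · refine absurd (Q.stabilizer.mul_mem (Q.gen_mem i) (Q.gen_mem i)) ?_
    rw [h2, hc, neg_smul, one_smul]
    exact Q.neg_one_notMem

theorem gen_conjTranspose (i) : (Q.gen i)ᴴ = Q.gen i := by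
  calc (Q.gen i)ᴴ = (Q.gen i)ᴴ * (Q.gen i * Q.gen i) := by rw [gen_mul_self, mul_one]
    _ = Q.gen i := by rw [← mul_assoc, (Q.isPauli i).conjTranspose_mul_self, one_mul]

theorem mul_self_of_mem {g} (hg : g ∈ Q.stabilizer) : g * g = 1 := by
  induction hg using Submonoid.closure_induction with
  | mem x hx => obtain ⟨j, rfl⟩ := hx; exact Q.gen_mul_self j
  | one => exact one_mul 1
  | mul x y hx' hy' hx hy =>
    have hc : y * x = x * y := Q.commute_of_mem hy' hx'
    rw [mul_assoc, ← mul_assoc y, hc, mul_assoc x y y, hy, mul_one, hx]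

theorem exists_hasSyndrome {E : Matrix (Qubits N) (Qubits N) ℂ} (hE : IsPauli E) :
    ∃ s, Q.HasSyndrome E s := by
  have h : ∀ i, ∃ x : Fin 2, Q.gen i * E = (-1 : ℂ) ^ (x : ℕ) • (E * Q.gen i) := by
    intro i
    obtain ⟨c, hc⟩ := (Q.isPauli i).comm hE
    rcases Int.units_eq_one_or c with rfl | rfl
    · exact ⟨0, by simpa using hc⟩
    · exact ⟨1, by simpa using hc⟩
  choose s hs using h
  exact ⟨s, hs⟩

theorem StabEquiv.refl (E : Matrix (Qubits N) (Qubits N) ℂ) : Q.StabEquiv E E :=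
  ⟨1, one_mem _, 1, by simp, by simp⟩

variable {Q} in
theorem StabEquiv.symm {E F : Matrix (Qubits N) (Qubits N) ℂ} (h : Q.StabEquiv E F) :
    Q.StabEquiv F E := by
  obtain ⟨g, hg, c, hc, rfl⟩ := h
  have hc0 : c ≠ 0 := by rintro rfl; simp at hc
  refine ⟨g, hg, c⁻¹, by simp [hc], ?_⟩
  rw [smul_mul_assoc, smul_smul, inv_mul_cancel₀ hc0, one_smul, mul_assoc, Q.mul_self_of_mem hg,
    mul_one]

/-- A Pauli operator that commutes with the generators up to signs acts on the code space as an
eigenvector of each factor of the syndrome projector. -/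
theorem syndromeProj_mulVec {E : Matrix (Qubits N) (Qubits N) ℂ} {s : Q.Syndrome}
    (hE : Q.HasSyndrome E s) {v : Qubits N → ℂ} (hv : Q.InCodeSpace v) (t : Q.Syndrome) :
    Q.syndromeProj t *ᵥ (E *ᵥ v) = if t = s then E *ᵥ v else 0 := by
  have h := list_ofFn_prod_mulVec
    (fun i => (2 : ℂ)⁻¹ • (1 + (-1 : ℂ) ^ (t i : ℕ) • Q.gen i))
    (fun i => if t i = s i then 1 else 0) (E *ᵥ v) (fun i => by
      have h1 : Q.gen i *ᵥ (E *ᵥ v) = (-1 : ℂ) ^ (s i : ℕ) • (E *ᵥ v) := by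
        rw [Matrix.mulVec_mulVec, hE i, Matrix.smul_mulVec, ← Matrix.mulVec_mulVec,
          hv _ (Q.gen_mem i)]
      -- Each factor of the projector has the eigenvalue `(1 + (-1)^(x+y)) / 2`, which tests whether
      -- the two outcomes agree.
      have h2 : ∀ x y : Fin 2, (if x = y then 1 else 0 : ℂ) =
          2⁻¹ * (1 + (-1) ^ (x : ℕ) * (-1) ^ (y : ℕ)) := by
        intro x y
        fin_cases x <;> fin_cases y <;> norm_num
      rw [Matrix.smul_mulVec, Matrix.add_mulVec, Matrix.one_mulVec, Matrix.smul_mulVec, h1,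
        smul_smul, h2]
      module)
  rw [syndromeProj, h]
  by_cases hts : t = s
  · simp [hts]
  · obtain ⟨i, hi⟩ := Function.ne_iff.mp hts
    rw [if_neg hts, Finset.prod_eq_zero (Finset.mem_univ i) (if_neg hi), zero_smul]

theorem hasSyndrome_one : Q.HasSyndrome 1 (fun _ => 0) := fun i => by simp

theorem syndromeProj_mulVec_of_inCodeSpace {v : Qubits N → ℂ} (hv : Q.InCodeSpace v) :
    Q.syndromeProj (fun _ => 0) *ᵥ v = v := by
  simpa using Q.syndromeProj_mulVec Q.hasSyndrome_one hv (fun _ => 0)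

theorem conjTranspose_syndromeProj (s : Q.Syndrome) : (Q.syndromeProj s)ᴴ = Q.syndromeProj s := by
  rw [syndromeProj, Matrix.conjTranspose_list_prod, List.map_ofFn]
  have h : (Matrix.conjTranspose ∘ fun i => (2 : ℂ)⁻¹ • (1 + (-1 : ℂ) ^ (s i : ℕ) • Q.gen i)) =
      fun i => (2 : ℂ)⁻¹ • (1 + (-1 : ℂ) ^ (s i : ℕ) • Q.gen i) := by
    funext i
    simp [Matrix.conjTranspose_smul, Q.gen_conjTranspose]
  rw [h]
  refine (List.reverse_perm _).prod_eq' ?_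
  rw [List.pairwise_reverse, List.pairwise_ofFn]
  intro i j _
  have hc : Commute (Q.gen j) (Q.gen i) := Q.comm j i
  exact (((Commute.one_left _).add_left (((Commute.one_right _).add_right
    (hc.smul_right _)).smul_left _)).smul_left _).smul_right _

theorem inCodeSpace_iff {v : Qubits N → ℂ} :
    Q.InCodeSpace v ↔ ∀ i, Q.gen i *ᵥ v = v := by
  refine ⟨fun h i => h _ (Q.gen_mem i), fun h g hg => ?_⟩
  induction hg using Submonoid.closure_induction with
  | mem x hx => obtain ⟨j, rfl⟩ := hx; exact h j
  | one => exact Matrix.one_mulVec v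
  | mul x y _ _ hx hy => rw [← Matrix.mulVec_mulVec, hy, hx]

/-- Through this the projector is a linear combination of stabilizer elements, the algebra being the
span of the monoid. -/
theorem syndromeProj_mem_adjoin (s : Q.Syndrome) :
    Q.syndromeProj s ∈ Algebra.adjoin ℂ (Set.range Q.gen) := by
  refine list_prod_mem fun x hx => ?_
  obtain ⟨i, rfl⟩ := List.mem_ofFn.mp hx
  exact Subalgebra.smul_mem _ (add_mem (one_mem _)
    (Subalgebra.smul_mem _ (Algebra.subset_adjoin (Set.mem_range_self i)) _)) _

theorem gen_mul_syndromeProj (i) :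
    Q.gen i * Q.syndromeProj (fun _ => 0) = Q.syndromeProj (fun _ => 0) := by
  have key : ∀ l : List (Fin (N - k)), i ∈ l →
      Q.gen i * (l.map fun j => (2 : ℂ)⁻¹ • (1 + (-1 : ℂ) ^ ((0 : Fin 2) : ℕ) • Q.gen j)).prod =
      (l.map fun j => (2 : ℂ)⁻¹ • (1 + (-1 : ℂ) ^ ((0 : Fin 2) : ℕ) • Q.gen j)).prod := by
    intro l
    induction l with
    | nil => simp
    | cons j l ih =>
      intro hi
      rw [List.map_cons, List.prod_cons, ← mul_assoc]
      rcases List.mem_cons.mp hi with rfl | hi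
      · congr 1
        simp [mul_add, Q.gen_mul_self, add_comm]
      · conv_rhs => rw [← ih hi]
        rw [← mul_assoc]
        congr 1
        simp [mul_add, add_mul, Q.comm i j]
  have := key (List.finRange (N - k)) (List.mem_finRange i)
  rwa [← List.ofFn_eq_map] at this

/-- A Pauli operator that acts as a scalar on a nonzero code space belongs to the stabilizer group,
up to a phase. -/
theorem exists_mem_stabilizer_of_scalar {F : Matrix (Qubits N) (Qubits N) ℂ} (hF : IsPauli F)
    {c : ℂ} (hc : ∀ v, Q.InCodeSpace v → F *ᵥ v = c • v) {v₀ : Qubits N → ℂ} (hv₀ : v₀ ≠ 0)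
    (hv₀Q : Q.InCodeSpace v₀) : ∃ g ∈ Q.stabilizer, ∃ d : ℂ, ‖d‖ = 1 ∧ F = d • g := by
  set X := Q.syndromeProj fun _ => 0 with hX
  have hcode : ∀ w, Q.InCodeSpace (X *ᵥ w) := fun w => Q.inCodeSpace_iff.mpr fun i => by
    rw [Matrix.mulVec_mulVec, Q.gen_mul_syndromeProj]
  have hFX : F * X = c • X := by
    refine Matrix.ext_of_mulVec_single fun i => ?_
    rw [← Matrix.mulVec_mulVec, hc _ (hcode _), Matrix.smul_mulVec]
  have hXX : X * X = X := by
    refine Matrix.ext_of_mulVec_single fun i => ?_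
    rw [← Matrix.mulVec_mulVec, Q.syndromeProj_mulVec_of_inCodeSpace (hcode _)]
  have hX0 : X ≠ 0 := by
    intro h
    have := Q.syndromeProj_mulVec_of_inCodeSpace hv₀Q
    rw [← hX, h, Matrix.zero_mulVec] at this
    exact hv₀ this.symm
  have htr : X.trace ≠ 0 := by
    intro h
    refine hX0 (Matrix.trace_conjTranspose_mul_self_eq_zero_iff.mp ?_)
    rw [Q.conjTranspose_syndromeProj, hXX, h]
  have hc0 : c ≠ 0 := by
    rintro rfl
    have h2 := hc _ hv₀Q
    have h3 : Fᴴ *ᵥ (F *ᵥ v₀) = v₀ := by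
      rw [Matrix.mulVec_mulVec, hF.conjTranspose_mul_self, Matrix.one_mulVec]
    rw [h2, zero_smul, Matrix.mulVec_zero] at h3
    exact hv₀ h3.symm
  have hFXtr : (F * X).trace ≠ 0 := by
    rw [hFX, Matrix.trace_smul, smul_eq_mul]
    exact mul_ne_zero hc0 htr
  -- Since `Tr (F X) ≠ 0` and `X` lies in the span of the stabilizer group, some `F g` has nonzero
  -- trace. As a Pauli operator it is then a phase.
  obtain ⟨g, hg, hgtr⟩ : ∃ g ∈ Q.stabilizer, (F * g).trace ≠ 0 := by
    by_contra! hcon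
    refine hFXtr ?_
    have hspan : X ∈ Submodule.span ℂ (Q.stabilizer : Set (Matrix (Qubits N) (Qubits N) ℂ)) := by
      have := Q.syndromeProj_mem_adjoin fun _ => 0
      rwa [← Subalgebra.mem_toSubmodule, Algebra.adjoin_eq_span] at this
    have hzero : ∀ Y ∈ Submodule.span ℂ (Q.stabilizer : Set (Matrix (Qubits N) (Qubits N) ℂ)),
        (F * Y).trace = 0 := by
      intro Y hY
      induction hY using Submodule.span_induction with
      | mem x hx => exact hcon x hx
      | zero => simp
      | add x y _ _ hx hy => rw [mul_add, Matrix.trace_add, hx, hy, add_zero]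
      | smul a x _ hx => rw [mul_smul_comm, Matrix.trace_smul, hx, smul_zero]
    exact hzero X hspan
  obtain ⟨d, hd, h⟩ := (hF.mul (Q.isPauli_of_mem hg)).eq_smul_one_of_trace_ne_zero hgtr
  refine ⟨g, hg, d, hd, ?_⟩
  calc F = F * g * g := by rw [mul_assoc, Q.mul_self_of_mem hg, mul_one]
    _ = d • g := by rw [h, smul_mul_assoc, one_mul]

end StabilizerCode

/-! ### Clifford encoders, logical errors and list decoders -/

namespace StabilizerCode

variable {N k : ℕ}

theorem encode_eq (C : Matrix (Qubits N) (Qubits k × Qubits (N - k)) ℂ) (ψ : Qubits k → ℂ) :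
    encode C ψ = C *ᵥ prodVec ψ (zeroKet (N - k)) := by
  rw [encode]
  congr 1
  ext a
  simp [prodVec, zeroKet]

theorem unencode_pureState (C : Matrix (Qubits N) (Qubits k × Qubits (N - k)) ℂ)
    (hC : Cᴴ * C = 1) (ψ : Qubits k → ℂ) (χ : Qubits (N - k) → ℂ) :
    unencode C (pureState (C *ᵥ prodVec ψ χ)) = (star χ ⬝ᵥ χ) • pureState ψ := by
  have h := mul_pureState_mul Cᴴ (C *ᵥ prodVec ψ χ)
  rw [Matrix.mulVec_mulVec, hC, Matrix.one_mulVec, Matrix.conjTranspose_conjTranspose] at h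
  ext a b
  rw [unencode, h]
  simp only [Matrix.of_apply, pureState, Matrix.vecMulVec_apply, prodVec, Pi.star_apply, star_mul',
    Matrix.smul_apply, smul_eq_mul, dotProduct, Finset.sum_mul]
  exact Finset.sum_congr rfl fun _ _ => by ring

theorem unencode_zero (C : Matrix (Qubits N) (Qubits k × Qubits (N - k)) ℂ) :
    unencode C 0 = 0 := by
  ext a b
  simp [unencode]

variable {Q : StabilizerCode N k} {C : Matrix (Qubits N) (Qubits k × Qubits (N - k)) ℂ}

theorem IsCliffordEncoder.mulVec_encode (hC : Q.IsCliffordEncoder C)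
    {E : Matrix (Qubits N) (Qubits N) ℂ} {P : Matrix (Qubits k) (Qubits k) ℂ}
    {A : Matrix (Qubits (N - k)) (Qubits (N - k)) ℂ} (h : Cᴴ * E * C = P ⊗ₖ A)
    (ψ : Qubits k → ℂ) :
    E *ᵥ encode C ψ = C *ᵥ prodVec (P *ᵥ ψ) (A *ᵥ zeroKet (N - k)) := by
  rw [encode_eq, ← kronecker_mulVec_prodVec, ← h, Matrix.mulVec_mulVec, Matrix.mulVec_mulVec]
  congr 1
  rw [← Matrix.mul_assoc, ← Matrix.mul_assoc, hC.coisometry, Matrix.one_mul]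

theorem IsCliffordEncoder.encode_mem (hC : Q.IsCliffordEncoder C) (ψ : Qubits k → ℂ) :
    Q.InCodeSpace (encode C ψ) := (hC.range _).mpr ⟨ψ, rfl⟩

theorem IsCliffordEncoder.mulVec_injective (hC : Q.IsCliffordEncoder C) {v w}
    (h : C *ᵥ v = C *ᵥ w) : v = w := by
  have := congrArg (Cᴴ *ᵥ ·) h
  simpa [Matrix.mulVec_mulVec, hC.isometry] using this

/-- The two equal signs cancel, so `E†F` preserves the code space. -/
theorem HasSyndrome.gen_commute {E F : Matrix (Qubits N) (Qubits N) ℂ} {s : Q.Syndrome}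
    (hE : Q.HasSyndrome E s) (hF : Q.HasSyndrome F s) (i) :
    Q.gen i * (Eᴴ * F) = Eᴴ * F * Q.gen i := by
  have h1 : Eᴴ * Q.gen i = (-1 : ℂ) ^ (s i : ℕ) • (Q.gen i * Eᴴ) := by
    have := congrArg Matrix.conjTranspose (hE i)
    simpa [Matrix.conjTranspose_mul, Q.gen_conjTranspose, Matrix.conjTranspose_smul] using this
  have hs : (-1 : ℂ) ^ (s i : ℕ) * (-1 : ℂ) ^ (s i : ℕ) = 1 := by
    rw [← mul_pow]; simp
  calc Q.gen i * (Eᴴ * F)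
      = ((-1 : ℂ) ^ (s i : ℕ) * (-1 : ℂ) ^ (s i : ℕ)) • (Q.gen i * Eᴴ * F) := by
        rw [hs, one_smul, mul_assoc]
    _ = (-1 : ℂ) ^ (s i : ℕ) • (Eᴴ * Q.gen i * F) := by
        rw [h1, smul_mul_assoc, smul_smul]
    _ = Eᴴ * F * Q.gen i := by
        rw [mul_assoc, hF i, mul_smul_comm, smul_smul, hs, one_smul, mul_assoc]

/-- Errors with the same syndrome and with logical errors that agree up to a phase are stabilizer
equivalent. -/
theorem IsCliffordEncoder.trace_eq_zero_of_not_stabEquiv (hC : Q.IsCliffordEncoder C)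
    {E F : Matrix (Qubits N) (Qubits N) ℂ} (hEP : IsPauli E) (hFP : IsPauli F) {s : Q.Syndrome}
    (hE : Q.HasSyndrome E s) (hF : Q.HasSyndrome F s) {P R : Matrix (Qubits k) (Qubits k) ℂ}
    (hP : IsLogicalError C E P) (hR : IsLogicalError C F R) (hEF : ¬ Q.StabEquiv E F) :
    (Pᴴ * R).trace = 0 := by
  by_contra htr
  obtain ⟨hPP, A, -, hA⟩ := hP
  obtain ⟨hRP, B, -, hB⟩ := hR
  obtain ⟨c, -, hc⟩ := (hPP.conjTranspose.mul hRP).eq_smul_one_of_trace_ne_zero htr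
  have hH : Cᴴ * (Eᴴ * F) * C = (Pᴴ * R) ⊗ₖ (Aᴴ * B) := by
    rw [Matrix.mul_kronecker_mul, ← Matrix.conjTranspose_kronecker, ← hA, ← hB]
    rw [Matrix.conjTranspose_mul, Matrix.conjTranspose_mul, Matrix.conjTranspose_conjTranspose]
    have h1 : F * C = C * (Cᴴ * (F * C)) := by
      rw [← Matrix.mul_assoc, hC.coisometry, Matrix.one_mul]
    rw [Matrix.mul_assoc, Matrix.mul_assoc Eᴴ, h1]
    simp only [Matrix.mul_assoc]
  set χ := (Aᴴ * B) *ᵥ zeroKet (N - k) with hχ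
  have hact : ∀ ψ, (Eᴴ * F) *ᵥ encode C ψ = C *ᵥ prodVec (c • ψ) χ := by
    intro ψ
    rw [hC.mulVec_encode hH, hc, Matrix.smul_mulVec, Matrix.one_mulVec]
  -- One encoded state suffices to find the action on the ancillas: its image is again encoded,
  -- which forces the ancilla vector `χ` back to a multiple of `|0…0⟩`.
  obtain ⟨ψ', hψ'⟩ := (hC.range ((Eᴴ * F) *ᵥ encode C (zeroKet k))).mp (by
    rw [inCodeSpace_iff]
    intro i
    rw [Matrix.mulVec_mulVec, hE.gen_commute hF i, ← Matrix.mulVec_mulVec,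
      (Q.inCodeSpace_iff.mp (hC.encode_mem _)) i])
  have hprod : prodVec (c • zeroKet k) χ = prodVec ψ' (zeroKet (N - k)) := by
    apply hC.mulVec_injective
    rw [← hact, hψ', encode_eq]
  have hcχ : c • χ = ψ' (zeroLabel k) • zeroKet (N - k) := by
    ext x
    have := congrFun hprod (zeroLabel k, x)
    simpa [prodVec, zeroKet] using this
  have hscalar : ∀ v, Q.InCodeSpace v → (Eᴴ * F) *ᵥ v = ψ' (zeroLabel k) • v := by
    intro v hv
    obtain ⟨ψ, rfl⟩ := (hC.range v).mp hv
    rw [hact, encode_eq, ← Matrix.mulVec_smul]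
    congr 1
    ext ⟨a, x⟩
    have := congrFun hcχ x
    simp only [Pi.smul_apply, smul_eq_mul, prodVec] at this ⊢
    linear_combination ψ a * this
  obtain ⟨g, hg, d, hd, h⟩ := Q.exists_mem_stabilizer_of_scalar (hEP.conjTranspose.mul hFP) hscalar
    (v₀ := encode C (zeroKet k)) (by
      intro h0
      rw [encode_eq, ← Matrix.mulVec_zero C] at h0
      have := congrFun (hC.mulVec_injective h0) (zeroLabel k, zeroLabel (N - k))
      simp [prodVec, zeroKet] at this) (hC.encode_mem _)
  refine hEF ⟨g, hg, d, hd, ?_⟩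
  calc F = E * (Eᴴ * F) := by rw [← mul_assoc, hEP.mul_conjTranspose_self, one_mul]
    _ = d • (E * g) := by rw [h, mul_smul_comm]

/-- The state after syndrome measurement and undoing the encoding, for an error that is stabilizer
equivalent to an error with logical error `P`. -/
theorem IsCliffordEncoder.unencode_syndromeProj (hC : Q.IsCliffordEncoder C)
    {E F : Matrix (Qubits N) (Qubits N) ℂ} {s : Q.Syndrome} (hE : Q.HasSyndrome E s)
    (hFE : Q.StabEquiv F E) {P : Matrix (Qubits k) (Qubits k) ℂ} (hP : IsLogicalError C F P)
    (ψ : Qubits k → ℂ) (t : Q.Syndrome) :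
    unencode C (Q.syndromeProj t * (E * pureState (encode C ψ) * Eᴴ) * Q.syndromeProj t) =
      if t = s then pureState (P *ᵥ ψ) else 0 := by
  conv_lhs => rw [mul_pureState_mul]; arg 2; arg 2; rw [← Q.conjTranspose_syndromeProj t]
  rw [mul_pureState_mul, Q.syndromeProj_mulVec hE (hC.encode_mem ψ)]
  split_ifs with hts
  · obtain ⟨g, hg, c, hc, rfl⟩ := hFE
    obtain ⟨-, A, hAP, hA⟩ := hP
    have hcc : star c * c = 1 := by
      have := Complex.conj_mul' c
      rw [hc] at this
      simpa using this
    rw [Matrix.smul_mulVec, ← Matrix.mulVec_mulVec, hC.encode_mem ψ g hg, hC.mulVec_encode hA,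
      pureState_smul, hcc, one_smul, unencode_pureState C hC.isometry, mulVec_dotProduct_mulVec,
      hAP.conjTranspose_mul_self, Matrix.one_mulVec, dotProduct_zeroKet, one_smul]
  · have : pureState (0 : Qubits N → ℂ) = 0 := by
      ext a b
      simp [pureState, Matrix.vecMulVec_apply]
    rw [this, unencode_zero]

theorem IsErrorList.length_le {ℰ : Set (Matrix (Qubits N) (Qubits N) ℂ)} {L : ℕ}
    (hL : Q.IsListDecodable ℰ L) {E : Matrix (Qubits N) (Qubits N) ℂ} (hE : E ∈ ℰ) {s : Q.Syndrome}
    (hs : Q.HasSyndrome E s) {l : List (Matrix (Qubits N) (Qubits N) ℂ)}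
    (hl : Q.IsErrorList ℰ s l) : l.length ≤ L := by
  classical
  have hnd : l.Nodup := by
    refine hl.2.1.imp ?_
    rintro a b hab rfl
    exact hab (StabEquiv.refl Q a)
  rw [← List.toFinset_card_of_nodup hnd]
  refine hL E hE s hs _ (fun F hF => hl.1 F (List.mem_toFinset.mp hF)) fun F hF G hG hFG => ?_
  have hsymm : Std.Symm fun E F => ¬ Q.StabEquiv E F := ⟨fun E F h h' => h h'.symm⟩
  exact hl.2.1.forall (List.mem_toFinset.mp hF) (List.mem_toFinset.mp hG) hFG

/-- The list of the measured syndrome contains the logical error that occurred, and the logical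
errors before it differ from it by a nontrivial Pauli operator. -/
theorem IsListDecoder.exists_split (hC : Q.IsCliffordEncoder C)
    {ℰ : Set (Matrix (Qubits N) (Qubits N) ℂ)} (hℰ : ∀ E ∈ ℰ, IsPauli E) {L : ℕ}
    (hL : Q.IsListDecodable ℰ L) {dec : Q.Syndrome → List (Matrix (Qubits k) (Qubits k) ℂ)}
    (hdec : Q.IsListDecoder C ℰ dec) {E : Matrix (Qubits N) (Qubits N) ℂ} (hE : E ∈ ℰ) :
    ∃ s l₁ P l₂, dec s = l₁ ++ P :: l₂ ∧ l₁.length < L ∧ IsPauli P ∧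
      (∀ B ∈ l₁, IsPauli B ∧ (Bᴴ * P).trace = 0) ∧
      ∀ ψ t, unencode C (Q.syndromeProj t * (E * pureState (encode C ψ) * Eᴴ) * Q.syndromeProj t) =
        if t = s then pureState (P *ᵥ ψ) else 0 := by
  obtain ⟨s, hs⟩ := Q.exists_hasSyndrome (hℰ E hE)
  obtain ⟨l, hl, hld⟩ := hdec s
  obtain ⟨F, hFl, hFE⟩ := hl.2.2 E hE hs
  have hlen := hl.length_le hL hE hs
  obtain ⟨e₁, e₂, rfl⟩ := List.append_of_mem hFl
  obtain ⟨l₁, l', hds, h₁, h'⟩ : ∃ l₁ l', dec s = l₁ ++ l' ∧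
      List.Forall₂ (IsLogicalError C) e₁ l₁ ∧ List.Forall₂ (IsLogicalError C) (F :: e₂) l' :=
    ⟨_, _, (List.take_append_drop e₁.length _).symm,
      (List.forall₂_take_append _ _ _ hld.flip).flip, (List.forall₂_drop_append _ _ _ hld.flip).flip⟩
  obtain ⟨P, l₂, hP, -, rfl⟩ := List.forall₂_cons_left_iff.mp h'
  refine ⟨s, l₁, P, l₂, hds, ?_, hP.1, ?_, fun ψ t => hC.unencode_syndromeProj hs hFE hP ψ t⟩
  -- The inequality is strict because the entry for the true error is itself among the at most `L`
  -- entries. In particular `L` is positive.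
  · rw [← h₁.length_eq]
    simp only [List.length_append, List.length_cons] at hlen
    omega
  · intro B hB
    obtain ⟨G, hG, hGB⟩ : ∃ G ∈ e₁, IsLogicalError C G B := by
      obtain ⟨i, hi, rfl⟩ := List.getElem_of_mem hB
      exact ⟨e₁[i]'(h₁.length_eq ▸ hi), List.getElem_mem _, h₁.get _ _⟩
    have hGF := (List.pairwise_append.mp hl.2.1).2.2 G hG F List.mem_cons_self
    have hGl := hl.1 G (List.mem_append_left _ hG)
    have hFl' := hl.1 F hFl
    exact ⟨hGB.1, hC.trace_eq_zero_of_not_stabEquiv (hℰ _ hGl.1) (hℰ _ hFl'.1) hGl.2 hFl'.2 hGB hP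
      hGF⟩

end StabilizerCode

/-! ### Second moments of the Haar measure and of exact 2-designs -/

section SecondMoment

variable {ι : Type} [Fintype ι]

theorem sum_fin_two_arrow (f : (Fin 2 → ι) → ℂ) : ∑ a, f a = ∑ i, ∑ j, f ![i, j] := by
  rw [← (finTwoArrowEquiv ι).symm.sum_comp, Fintype.sum_prod_type]
  rfl

/-- `Tr (F V A V† F† V T V†)`. -/
def overlap (A T F V : Matrix ι ι ℂ) : ℂ := (F * (V * A * Vᴴ) * Fᴴ * (V * T * Vᴴ)).trace

/-- Cyclicity of the trace moves `W` onto `F`; with Haar invariance the mean depends only on the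
unitary orbit of `F`. -/
theorem overlap_conj (A T F V W : Matrix ι ι ℂ) :
    overlap A T F (W * V) = overlap A T (Wᴴ * F * W) V := by
  simp only [overlap, Matrix.conjTranspose_mul, Matrix.conjTranspose_conjTranspose]
  calc (F * (W * V * A * (Vᴴ * Wᴴ)) * Fᴴ * (W * V * T * (Vᴴ * Wᴴ))).trace
      = (F * (W * V * A * (Vᴴ * Wᴴ)) * Fᴴ * (W * V * T * Vᴴ) * Wᴴ).trace := by
        simp only [Matrix.mul_assoc]
    _ = _ := by
        rw [Matrix.trace_mul_comm]
        simp only [Matrix.mul_assoc]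

/-- The linear functional `σ ⊗ R ↦ Tr (F σ F† R)` on operators on two copies. -/
def contract (F : Matrix ι ι ℂ) (Y : Matrix (Fin 2 → ι) (Fin 2 → ι) ℂ) : ℂ :=
  ∑ a, ∑ b, F (b 1) (a 0) * Fᴴ (b 0) (a 1) * Y a b

/-- This exhibits the overlap as linear in `V^{⊗2} (A ⊗ T) V^{†⊗2}`, so that second moments
determine its mean. -/
theorem contract_piTensor (F σ R : Matrix ι ι ℂ) :
    contract F (piTensor ![σ, R]) = (F * σ * Fᴴ * R).trace := by
  simp only [contract, sum_fin_two_arrow, piTensor, Matrix.of_apply, Fin.prod_univ_two,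
    Matrix.cons_val_zero, Matrix.cons_val_one, Matrix.trace, Matrix.diag, Matrix.mul_apply,
    Finset.sum_mul]
  calc ∑ j, ∑ l, ∑ k, ∑ i, F i j * Fᴴ k l * (σ j k * R l i)
      = ∑ j, ∑ l, ∑ i, ∑ k, F i j * Fᴴ k l * (σ j k * R l i) := by
        refine Finset.sum_congr rfl fun _ _ => Finset.sum_congr rfl fun _ _ => Finset.sum_comm
    _ = ∑ j, ∑ i, ∑ l, ∑ k, F i j * Fᴴ k l * (σ j k * R l i) := by
        refine Finset.sum_congr rfl fun _ _ => Finset.sum_comm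
    _ = ∑ i, ∑ j, ∑ l, ∑ k, F i j * Fᴴ k l * (σ j k * R l i) := Finset.sum_comm
    _ = ∑ i, ∑ l, ∑ j, ∑ k, F i j * Fᴴ k l * (σ j k * R l i) := by
        refine Finset.sum_congr rfl fun _ _ => Finset.sum_comm
    _ = ∑ i, ∑ l, ∑ k, ∑ j, F i j * σ j k * Fᴴ k l * R l i := by
        refine Finset.sum_congr rfl fun _ _ => Finset.sum_congr rfl fun _ _ => ?_
        rw [Finset.sum_comm]
        exact Finset.sum_congr rfl fun _ _ => Finset.sum_congr rfl fun _ _ => by ring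

/-- For `F = B†P` this is the probability that the test of `B` succeeds when `P` occurred. -/
theorem overlap_pureState {φ : ι → ℂ} {T : Matrix ι ι ℂ} (hT : Tᴴ = T) (hTT : T * T = T)
    (F V : Matrix ι ι ℂ) :
    overlap (pureState φ) T F V =
      star ((T * Vᴴ * F * V) *ᵥ φ) ⬝ᵥ ((T * Vᴴ * F * V) *ᵥ φ) := by
  rw [overlap, mul_pureState_mul, mul_pureState_mul, pureState, Matrix.trace_mul_comm,
    Matrix.mul_vecMulVec, Matrix.trace_vecMulVec, dotProduct_comm, Matrix.mulVec_mulVec,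
    mulVec_dotProduct_mulVec, mulVec_dotProduct_mulVec]
  have h : (F * V)ᴴ * (V * T * Vᴴ * (F * V)) = (T * Vᴴ * F * V)ᴴ * (T * Vᴴ * F * V) := by
    simp only [Matrix.conjTranspose_mul, Matrix.conjTranspose_conjTranspose, hT]
    conv_lhs => rw [← hTT]
    simp only [Matrix.mul_assoc]
  rw [← h, Matrix.mulVec_mulVec]
  simp only [Matrix.mul_assoc]

theorem overlap_pureState_re_nonneg {φ : ι → ℂ} {T : Matrix ι ι ℂ} (hT : Tᴴ = T) (hTT : T * T = T)
    (F V : Matrix ι ι ℂ) : 0 ≤ (overlap (pureState φ) T F V).re := by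
  rw [overlap_pureState hT hTT]
  exact (Complex.nonneg_iff.mp (dotProduct_star_self_nonneg _)).1

variable [DecidableEq ι]

instance : (unitaryHaar ι).IsHaarMeasure := by
  unfold unitaryHaar
  infer_instance

instance : IsProbabilityMeasure (unitaryHaar ι) := by
  refine ⟨?_⟩
  unfold unitaryHaar
  exact Measure.haarMeasure_self (K₀ := (⊤ : TopologicalSpace.PositiveCompacts _))

theorem conjTensor_piTensor (V : Matrix.unitaryGroup ι ℂ) (A T : Matrix ι ι ℂ) :
    conjTensor 2 V (piTensor ![A, T]) =
      piTensor ![(V : Matrix ι ι ℂ) * A * (V : Matrix ι ι ℂ)ᴴ,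
        (V : Matrix ι ι ℂ) * T * (V : Matrix ι ι ℂ)ᴴ] := by
  have h : tensorPow 2 (V : Matrix ι ι ℂ) = piTensor fun _ => (V : Matrix ι ι ℂ) := rfl
  rw [conjTensor, h, piTensor_conjTranspose, piTensor_mul, piTensor_mul]
  congr 1
  funext i
  fin_cases i <;> rfl

theorem contract_conjTensor (F : Matrix ι ι ℂ) (V : Matrix.unitaryGroup ι ℂ) (A T : Matrix ι ι ℂ) :
    contract F (conjTensor 2 V (piTensor ![A, T])) = overlap A T F V := by
  rw [conjTensor_piTensor, contract_piTensor, overlap]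

theorem continuous_conjTensor_apply (t : ℕ) (X : Matrix (Fin t → ι) (Fin t → ι) ℂ) (a b) :
    Continuous fun V : Matrix.unitaryGroup ι ℂ => conjTensor t V X a b := by
  have hV : ∀ i j, Continuous fun V : Matrix.unitaryGroup ι ℂ => (V : Matrix ι ι ℂ) i j :=
    fun i j => continuous_subtype_val.matrix_elem i j
  have hp : ∀ a b : Fin t → ι,
      Continuous fun V : Matrix.unitaryGroup ι ℂ => ∏ i, (V : Matrix ι ι ℂ) (a i) (b i) :=
    fun a b => continuous_finsetProd _ fun i _ => hV _ _
  simp only [conjTensor, tensorPow, Matrix.mul_apply, Matrix.conjTranspose_apply, Matrix.of_apply]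
  exact continuous_finsetSum _ fun j _ => (continuous_finsetSum _ fun l _ =>
    (hp a l).mul continuous_const).mul (hp b j).star

theorem integrable_of_continuous {f : Matrix.unitaryGroup ι ℂ → ℂ} (hf : Continuous f) :
    Integrable f (unitaryHaar ι) :=
  hf.integrable_of_hasCompactSupport (HasCompactSupport.of_compactSpace f)

theorem continuous_overlap (A T F : Matrix ι ι ℂ) :
    Continuous fun V : Matrix.unitaryGroup ι ℂ => overlap A T F V := by
  simp only [← contract_conjTensor, contract]
  have := fun a b => continuous_conjTensor_apply (ι := ι) 2 (piTensor ![A, T]) a b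
  fun_prop

theorem contract_haarTwirl (A T F : Matrix ι ι ℂ) :
    contract F (haarTwirl 2 (piTensor ![A, T])) = ∫ V, overlap A T F V ∂(unitaryHaar ι) := by
  have hi := fun a b => integrable_of_continuous
    (continuous_conjTensor_apply (ι := ι) 2 (piTensor ![A, T]) a b)
  simp only [← contract_conjTensor]
  simp only [contract, haarTwirl, Matrix.of_apply]
  rw [integral_finsetSum _ fun a _ => integrable_finsetSum _ fun b _ => (hi a b).const_mul _]
  refine Finset.sum_congr rfl fun a _ => ?_
  rw [integral_finsetSum _ fun b _ => (hi a b).const_mul _]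
  exact Finset.sum_congr rfl fun b _ => (integral_const_mul _ _).symm

theorem contract_keyTwirl {K : Type} [Fintype K] (U : K → Matrix.unitaryGroup ι ℂ)
    (A T F : Matrix ι ι ℂ) :
    contract F (keyTwirl U 2 (piTensor ![A, T])) =
      (Fintype.card K : ℂ)⁻¹ * ∑ key, overlap A T F (U key) := by
  simp only [← contract_conjTensor]
  simp only [contract, keyTwirl, Matrix.smul_apply, Matrix.sum_apply, smul_eq_mul]
  rw [Finset.sum_comm (s := Finset.univ (α := K)), Finset.mul_sum]
  refine Finset.sum_congr rfl fun a _ => ?_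
  rw [Finset.sum_comm (s := Finset.univ (α := K)), Finset.mul_sum]
  refine Finset.sum_congr rfl fun b _ => ?_
  rw [← Finset.mul_sum]
  ring

theorem sum_overlap_eq_of_isExactDesign {K : Type} [Fintype K] [Nonempty K]
    {U : K → Matrix.unitaryGroup ι ℂ} (hU : IsExactDesign 2 U) (A T F : Matrix ι ι ℂ) :
    ∑ key, overlap A T F (U key) = Fintype.card K * ∫ V, overlap A T F V ∂(unitaryHaar ι) := by
  rw [← contract_haarTwirl, ← hU, contract_keyTwirl, mul_inv_cancel_left₀]
  simp

theorem integral_overlap_conj (A T F : Matrix ι ι ℂ) (W : Matrix.unitaryGroup ι ℂ) :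
    ∫ V, overlap A T ((W : Matrix ι ι ℂ)ᴴ * F * W) V ∂(unitaryHaar ι) =
      ∫ V, overlap A T F V ∂(unitaryHaar ι) := by
  rw [← integral_mul_left_eq_self (μ := unitaryHaar ι) (fun V => overlap A T F V) W]
  simp only [Submonoid.coe_mul, overlap_conj]

theorem overlap_smul (A T F V : Matrix ι ι ℂ) (c : ℂ) :
    overlap A T (c • F) V = (c * star c) * overlap A T F V := by
  simp only [overlap, Matrix.conjTranspose_smul, smul_mul_assoc, mul_smul_comm, Matrix.trace_smul,
    smul_eq_mul]
  ring

/-- For anticommuting reflections `F` and `G`, the matrix `W = (F + G) / √2` is unitary and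
satisfies `W† F W = G`. -/
theorem integral_overlap_eq_of_anticomm (A T : Matrix ι ι ℂ) {F G : Matrix ι ι ℂ} (hF : Fᴴ = F)
    (hG : Gᴴ = G) (hFF : F * F = 1) (hGG : G * G = 1) (hFG : G * F = -(F * G)) :
    ∫ V, overlap A T G V ∂(unitaryHaar ι) = ∫ V, overlap A T F V ∂(unitaryHaar ι) := by
  set c : ℂ := ((Real.sqrt 2 : ℝ) : ℂ)⁻¹ with hc
  have hcc : c * c = 2⁻¹ := by
    rw [hc, ← mul_inv, ← Complex.ofReal_mul, Real.mul_self_sqrt (by norm_num)]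
    norm_num
  have hcs : star c = c := by
    rw [hc, star_inv₀]
    congr 1
    exact Complex.conj_ofReal _
  have hWH : (c • (F + G))ᴴ = c • (F + G) := by
    rw [Matrix.conjTranspose_smul, Matrix.conjTranspose_add, hF, hG, hcs]
  have hWW : c • (F + G) * c • (F + G) = 1 := by
    rw [smul_mul_smul_comm, hcc, mul_add, add_mul, add_mul, hFF, hGG, hFG]
    rw [show (1 : Matrix ι ι ℂ) + -(F * G) + (F * G + 1) = (2 : ℂ) • 1 by
      rw [two_smul]; abel, smul_smul]
    norm_num
  have hW : c • (F + G) ∈ Matrix.unitaryGroup ι ℂ := by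
    rw [Matrix.mem_unitaryGroup_iff, Matrix.star_eq_conjTranspose, hWH, hWW]
  have hconj : (c • (F + G))ᴴ * F * (c • (F + G)) = G := by
    have h1 : G * F * G = -F := by rw [hFG, neg_mul, mul_assoc, hGG, mul_one]
    rw [hWH, smul_mul_assoc, smul_mul_smul_comm, hcc, add_mul, mul_add, add_mul, add_mul, hFF,
      one_mul, one_mul, h1, mul_assoc G F F, hFF, mul_one]
    rw [show F + G + (G + -F) = (2 : ℂ) • G by rw [two_smul]; abel, smul_smul]
    norm_num
  have := integral_overlap_conj A T F ⟨_, hW⟩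
  simpa only [hconj] using this

end SecondMoment

/-- Under the Haar measure a nontrivial Pauli operator `F` is typically far from preserving the
range of the projector `T`: `𝔼 ‖T V† F V φ‖² ≤ 2 Tr(T) / 2^k`. -/
theorem integral_overlap_le {k : ℕ} {φ : Qubits k → ℂ} (hφ : star φ ⬝ᵥ φ = 1)
    {T : Matrix (Qubits k) (Qubits k) ℂ} (hT : Tᴴ = T) (hTT : T * T = T)
    {F : Matrix (Qubits k) (Qubits k) ℂ} (hF : IsPauli F) (hFtr : F.trace = 0) :
    (∫ V, overlap (pureState φ) T F V ∂(unitaryHaar (Qubits k))).re ≤ 2 * T.trace.re / 2 ^ k := by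
  obtain ⟨d, P, rfl⟩ := hF
  have hd : Complex.I ^ d * star (Complex.I ^ d) = 1 := by
    rw [star_pow, ← mul_pow]
    simp
  simp only [overlap_smul, hd, one_mul]
  have hPtr : (pauliString P).trace = 0 := by
    rw [Matrix.trace_smul, smul_eq_mul] at hFtr
    exact (mul_eq_zero.mp hFtr).resolve_left (pow_ne_zero _ Complex.I_ne_zero)
  choose χ hχ using fun R => pauliString_comm (k := k) R P
  obtain ⟨g, hg⟩ : ∃ g : (Fin k → Fin 4) → ℝ, ∀ R, g R =
      (∫ V, overlap (pureState φ) T (pauliString R) V ∂(unitaryHaar (Qubits k))).re :=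
    ⟨_, fun _ => rfl⟩
  rw [← hg]
  have hre : ∀ R, g R = ∫ V, (overlap (pureState φ) T (pauliString R)
      (V : Matrix.unitaryGroup (Qubits k) ℂ)).re ∂(unitaryHaar (Qubits k)) := fun R =>
    (hg R).trans (integral_re (integrable_of_continuous (continuous_overlap _ _ _))).symm
  have hg0 : ∀ R, 0 ≤ g R := fun R => by
    rw [hre]
    exact integral_nonneg fun V => overlap_pureState_re_nonneg hT hTT _ _
  -- The weight `1 - χ R` is `2` on the strings that anticommute with `P` and `0` on the others.
  have hsym : ∀ R, (1 - ((χ R : ℤ) : ℝ)) * g R = (1 - ((χ R : ℤ) : ℝ)) * g P := by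
    intro R
    rcases Int.units_eq_one_or (χ R) with h | h
    · simp [h]
    · congr 1
      rw [hg, hg, integral_overlap_eq_of_anticomm _ _ (pauliString_conjTranspose P)
        (pauliString_conjTranspose R) (pauliString_mul_self P) (pauliString_mul_self R)]
      rw [hχ R, h]
      simp
  -- The twirl of the traceless `P` is both `0` and the sum of the signs times `P`: half of all
  -- strings anticommute with `P`.
  have hχ0 : ∑ R, ((χ R : ℤ) : ℝ) = 0 := by
    have h1 := sum_pauliString_conj (pauliString P)
    rw [hPtr, mul_zero, zero_smul] at h1
    have h2 : (∑ R, ((χ R : ℤ) : ℂ)) • pauliString P = 0 := by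
      rw [← h1, Finset.sum_smul]
      refine Finset.sum_congr rfl fun R _ => ?_
      rw [hχ R, smul_mul_assoc, mul_assoc, pauliString_mul_self, mul_one]
    have h3 : pauliString P ≠ 0 := by
      intro h
      have := pauliString_mul_self P
      rw [h, zero_mul] at this
      exact zero_ne_one this
    have h4 := (smul_eq_zero.mp h2).resolve_right h3
    exact_mod_cast h4
  have hsum : ∑ R, g R = 2 ^ k * T.trace.re := by
    have h1 : ∀ V : Matrix.unitaryGroup (Qubits k) ℂ,
        ∑ R, overlap (pureState φ) T (pauliString R) V = 2 ^ k * T.trace := by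
      intro V
      have hV : (V : Matrix (Qubits k) (Qubits k) ℂ)ᴴ * V = 1 :=
        Matrix.mem_unitaryGroup_iff'.mp V.2
      simp only [overlap, pauliString_conjTranspose]
      rw [← Matrix.trace_sum, ← Finset.sum_mul, sum_pauliString_conj, smul_mul_assoc, one_mul,
        Matrix.trace_smul, Matrix.trace_mul_comm _ (Vᴴ : Matrix (Qubits k) (Qubits k) ℂ),
        ← Matrix.mul_assoc, hV, Matrix.one_mul,
        Matrix.trace_mul_comm _ (Vᴴ : Matrix (Qubits k) (Qubits k) ℂ),
        ← Matrix.mul_assoc, hV, Matrix.one_mul, pureState, Matrix.trace_vecMulVec, dotProduct_comm,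
        hφ, mul_one, smul_eq_mul]
    have h2 : ∑ R, ∫ V, overlap (pureState φ) T (pauliString R)
        (V : Matrix.unitaryGroup (Qubits k) ℂ) ∂(unitaryHaar (Qubits k)) = 2 ^ k * T.trace := by
      rw [← integral_finsetSum _ fun R _ => integrable_of_continuous (continuous_overlap _ _ _)]
      simp only [h1, integral_const, probReal_univ, one_smul]
    simp only [hg]
    rw [← Complex.re_sum, h2]
    have : ((2 : ℂ) ^ k) = (((2 : ℝ) ^ k : ℝ) : ℂ) := by push_cast; rfl
    rw [this, Complex.re_ofReal_mul]
  have hkey : (4 : ℝ) ^ k * g P ≤ 2 * (2 ^ k * T.trace.re) := by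
    calc (4 : ℝ) ^ k * g P = ∑ R, (1 - ((χ R : ℤ) : ℝ)) * g P := by
          rw [← Finset.sum_mul, Finset.sum_sub_distrib, hχ0]
          simp
      _ = ∑ R, (1 - ((χ R : ℤ) : ℝ)) * g R := Finset.sum_congr rfl fun R _ => (hsym R).symm
      _ ≤ ∑ R, 2 * g R := by
          refine Finset.sum_le_sum fun R _ => mul_le_mul_of_nonneg_right ?_ (hg0 R)
          rcases Int.units_eq_one_or (χ R) with h | h <;> norm_num [h]
      _ = _ := by rw [← Finset.mul_sum, hsum]
  rw [show (4 : ℝ) = 2 * 2 by norm_num, mul_pow] at hkey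
  have h2k : (0 : ℝ) < 2 ^ k := by positivity
  rw [le_div_iff₀ h2k]
  refine le_of_mul_le_mul_left ?_ h2k
  linarith

/-- The average over the keys of an exact 2-design of `‖T U† F U φ‖²`, for a nontrivial Pauli
operator `F`. -/
theorem sum_overlap_le_of_isExactDesign {k : ℕ} {φ : Qubits k → ℂ} (hφ : star φ ⬝ᵥ φ = 1)
    {T : Matrix (Qubits k) (Qubits k) ℂ} (hT : Tᴴ = T) (hTT : T * T = T)
    {F : Matrix (Qubits k) (Qubits k) ℂ} (hF : IsPauli F) (hFtr : F.trace = 0)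
    {K : Type} [Fintype K] [Nonempty K] {U : K → Matrix.unitaryGroup (Qubits k) ℂ}
    (hU : IsExactDesign 2 U) :
    ∑ key, (overlap (pureState φ) T F (U key)).re ≤
      Fintype.card K * (2 * T.trace.re / 2 ^ k) := by
  rw [← Complex.re_sum, sum_overlap_eq_of_isExactDesign hU, ← Complex.ofReal_natCast,
    Complex.re_ofReal_mul]
  exact mul_le_mul_of_nonneg_left (integral_overlap_le hφ hT hTT hF hFtr) (Nat.cast_nonneg _)

/-! ### The search loop on pure states -/

section SearchLoop

variable {ι : Type} [Fintype ι]

/-- The Euclidean norm of a state vector. -/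
noncomputable def vnorm (v : ι → ℂ) : ℝ := ‖(WithLp.toLp 2 v : EuclideanSpace ℂ ι)‖

theorem vnorm_nonneg (v : ι → ℂ) : 0 ≤ vnorm v := norm_nonneg _

theorem dotProduct_star_self (v : ι → ℂ) : star v ⬝ᵥ v = ((vnorm v ^ 2 : ℝ) : ℂ) := by
  have h := inner_self_eq_norm_sq_to_K (𝕜 := ℂ) (WithLp.toLp 2 v : EuclideanSpace ℂ ι)
  rw [EuclideanSpace.inner_eq_star_dotProduct] at h
  rw [dotProduct_comm, vnorm]
  exact_mod_cast h

theorem norm_star_dotProduct_le (v w : ι → ℂ) : ‖star v ⬝ᵥ w‖ ≤ vnorm v * vnorm w := by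
  have h := norm_inner_le_norm (𝕜 := ℂ) (WithLp.toLp 2 v : EuclideanSpace ℂ ι) (WithLp.toLp 2 w)
  rwa [EuclideanSpace.inner_eq_star_dotProduct, dotProduct_comm] at h

theorem vnorm_sub_le_add (u v w : ι → ℂ) : vnorm (u - w) ≤ vnorm (u - v) + vnorm (v - w) :=
  norm_sub_le_norm_sub_add_norm_sub (WithLp.toLp 2 u : EuclideanSpace ℂ ι) (WithLp.toLp 2 v)
    (WithLp.toLp 2 w)

theorem vnorm_eq_one {v : ι → ℂ} (h : star v ⬝ᵥ v = 1) : vnorm v = 1 := by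
  rw [dotProduct_star_self] at h
  have h' : vnorm v ^ 2 = 1 := by exact_mod_cast h
  exact (pow_eq_one_iff_of_nonneg (vnorm_nonneg v) two_ne_zero).mp h'

theorem vnorm_mulVec_le_of_proj {A : Matrix ι ι ℂ} (hA : Aᴴ = A) (hAA : A * A = A) (v : ι → ℂ) :
    vnorm (A *ᵥ v) ≤ vnorm v := by
  have h := mulVec_dotProduct_mulVec A A v v
  have h2 := norm_star_dotProduct_le v (A *ᵥ v)
  rw [hA, hAA, dotProduct_star_self] at h
  rw [← h, Complex.norm_real, Real.norm_of_nonneg (sq_nonneg _)] at h2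
  by_contra! hlt
  have := vnorm_nonneg v
  nlinarith

theorem trace_pureState (w : ι → ℂ) : (pureState w).trace = ((vnorm w ^ 2 : ℝ) : ℂ) := by
  rw [pureState, Matrix.trace_vecMulVec, dotProduct_comm, dotProduct_star_self]

theorem posSemidef_pureState (w : ι → ℂ) : (pureState w).PosSemidef :=
  Matrix.posSemidef_vecMulVec_self_star w

variable [DecidableEq ι]

theorem vnorm_mulVec_of_isometry {A : Matrix ι ι ℂ} (hA : Aᴴ * A = 1) (v : ι → ℂ) :
    vnorm (A *ᵥ v) = vnorm v := by
  have h := mulVec_dotProduct_mulVec A A v v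
  rw [hA, Matrix.one_mulVec, dotProduct_star_self, dotProduct_star_self] at h
  have h' : vnorm (A *ᵥ v) ^ 2 = vnorm v ^ 2 := by exact_mod_cast h
  exact (sq_eq_sq₀ (vnorm_nonneg _) (vnorm_nonneg _)).mp h'

/-- The operator applied to the state by an unsuccessful test of the logical error `B`. -/
def failStep (U T B : Matrix ι ι ℂ) : Matrix ι ι ℂ := B * U * (1 - T) * (B * U)ᴴ

/-- The unnormalised state after unsuccessful tests of all elements of a list. -/
def afterFailures (U T : Matrix ι ι ℂ) : List (Matrix ι ι ℂ) → (ι → ℂ) → ι → ℂ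
  | [], v => v
  | B :: l, v => afterFailures U T l (failStep U T B *ᵥ v)

/-- Every branch maps pure states to pure states, which reduces the analysis of the loop to vectors.
-/
theorem searchLoop_cons_pureState {U T : Matrix ι ι ℂ} (hT : Tᴴ = T) (B : Matrix ι ι ℂ)
    (l : List (Matrix ι ι ℂ)) (v : ι → ℂ) :
    searchLoop U T (B :: l) (pureState v) = pureState ((T * (B * U)ᴴ) *ᵥ v) ::
      searchLoop U T l (pureState (failStep U T B *ᵥ v)) := by
  have h1T : (1 - T)ᴴ = 1 - T := by rw [Matrix.conjTranspose_sub, Matrix.conjTranspose_one, hT]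
  simp only [searchLoop]
  rw [← mul_pureState_mul, ← mul_pureState_mul, failStep]
  simp only [Matrix.conjTranspose_mul, Matrix.conjTranspose_conjTranspose, h1T, hT]
  simp only [mul_assoc]

theorem exists_eq_pureState_of_mem_searchLoop {U T : Matrix ι ι ℂ} (hT : Tᴴ = T)
    (l : List (Matrix ι ι ℂ)) (v : ι → ℂ) {ω : Matrix ι ι ℂ}
    (hω : ω ∈ searchLoop U T l (pureState v)) : ∃ w, ω = pureState w := by
  induction l generalizing v with
  | nil => simp [searchLoop] at hω
  | cons B l ih =>
    rw [searchLoop_cons_pureState hT] at hω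
    rcases List.mem_cons.mp hω with h | h
    · exact ⟨_, h⟩
    · exact ih _ h

theorem sum_map_searchLoop_nonneg {U T : Matrix ι ι ℂ} (hT : Tᴴ = T) {f : Matrix ι ι ℂ → ℝ}
    (hf : ∀ w, 0 ≤ f (pureState w)) (l : List (Matrix ι ι ℂ)) (v : ι → ℂ) :
    0 ≤ ((searchLoop U T l (pureState v)).map f).sum := by
  refine List.sum_nonneg fun x hx => ?_
  obtain ⟨ω, hω, rfl⟩ := List.mem_map.mp hx
  obtain ⟨w, rfl⟩ := exists_eq_pureState_of_mem_searchLoop hT l v hω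
  exact hf w

/-- Only the branch that halts at `P` is kept; the others contribute nonnegative terms. -/
theorem le_sum_map_searchLoop {U T : Matrix ι ι ℂ} (hT : Tᴴ = T) {f : Matrix ι ι ℂ → ℝ}
    (hf : ∀ w, 0 ≤ f (pureState w)) (l₁ : List (Matrix ι ι ℂ)) (P : Matrix ι ι ℂ)
    (l₂ : List (Matrix ι ι ℂ)) (v : ι → ℂ) :
    f (pureState ((T * (P * U)ᴴ) *ᵥ afterFailures U T l₁ v)) ≤
      ((searchLoop U T (l₁ ++ P :: l₂) (pureState v)).map f).sum := by
  induction l₁ generalizing v with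
  | nil =>
    rw [List.nil_append, searchLoop_cons_pureState hT, List.map_cons, List.sum_cons, afterFailures]
    exact le_add_of_nonneg_right (sum_map_searchLoop_nonneg hT hf _ _)
  | cons B l ih =>
    rw [List.cons_append, searchLoop_cons_pureState hT, List.map_cons, List.sum_cons, afterFailures]
    exact (ih _).trans (le_add_of_nonneg_left (hf _))

/-- A failed test is the orthogonal projection `1 - T` conjugated by the unitary `B U`. -/
theorem vnorm_failStep_le {U T : Matrix ι ι ℂ} (hT : Tᴴ = T) (hTT : T * T = T)
    (hU : Uᴴ * U = 1) {B : Matrix ι ι ℂ} (hB : Bᴴ * B = 1) (v : ι → ℂ) :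
    vnorm (failStep U T B *ᵥ v) ≤ vnorm v := by
  have hBU : (B * U)ᴴ * (B * U) = 1 := by
    rw [Matrix.conjTranspose_mul, mul_assoc, ← mul_assoc Bᴴ, hB, one_mul, hU]
  have h1T : (1 - T)ᴴ = 1 - T := by rw [Matrix.conjTranspose_sub, Matrix.conjTranspose_one, hT]
  have h11 : (1 - T) * (1 - T) = 1 - T := by
    rw [mul_sub, mul_one, sub_mul, hTT, one_mul, sub_self, sub_zero]
  refine vnorm_mulVec_le_of_proj ?_ ?_ v
  · rw [failStep, Matrix.conjTranspose_mul _ (B * U)ᴴ, Matrix.conjTranspose_mul _ (1 - T), h1T,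
      Matrix.conjTranspose_conjTranspose, mul_assoc (B * U)]
  · calc failStep U T B * failStep U T B
        = B * U * (1 - T) * ((B * U)ᴴ * (B * U)) * (1 - T) * (B * U)ᴴ := by
          simp only [failStep, mul_assoc]
      _ = B * U * ((1 - T) * (1 - T)) * (B * U)ᴴ := by rw [hBU]; simp only [mul_assoc, mul_one]
      _ = failStep U T B := by rw [h11, failStep]

theorem vnorm_afterFailures_sub_le {U T : Matrix ι ι ℂ} (hT : Tᴴ = T) (hTT : T * T = T)
    (hU : Uᴴ * U = 1) {l : List (Matrix ι ι ℂ)} (hl : ∀ B ∈ l, Bᴴ * B = 1)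
    (v w : ι → ℂ) : vnorm (afterFailures U T l v - afterFailures U T l w) ≤ vnorm (v - w) := by
  induction l generalizing v w with
  | nil => exact le_rfl
  | cons B l ih =>
    refine (ih (fun C hC => hl C (List.mem_cons_of_mem _ hC)) _ _).trans ?_
    rw [← Matrix.mulVec_sub]
    exact vnorm_failStep_le hT hTT hU (hl B List.mem_cons_self) _

theorem vnorm_afterFailures_le {U T : Matrix ι ι ℂ} (hT : Tᴴ = T) (hTT : T * T = T)
    (hU : Uᴴ * U = 1) {l : List (Matrix ι ι ℂ)} (hl : ∀ B ∈ l, Bᴴ * B = 1)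
    (v : ι → ℂ) : vnorm (afterFailures U T l v) ≤ vnorm v := by
  induction l generalizing v with
  | nil => exact le_rfl
  | cons B l ih =>
    exact (ih (fun C hC => hl C (List.mem_cons_of_mem _ hC)) _).trans
      (vnorm_failStep_le hT hTT hU (hl B List.mem_cons_self) _)

/-- Unsuccessful tests that are each likely to fail hardly disturb the state. -/
theorem vnorm_sub_afterFailures_le {U T : Matrix ι ι ℂ} (hT : Tᴴ = T) (hTT : T * T = T)
    (hU : Uᴴ * U = 1) (hU' : U * Uᴴ = 1) {l : List (Matrix ι ι ℂ)}
    (hl : ∀ B ∈ l, Bᴴ * B = 1 ∧ B * Bᴴ = 1) (v : ι → ℂ) :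
    vnorm (v - afterFailures U T l v) ≤ (l.map fun B => vnorm ((T * (B * U)ᴴ) *ᵥ v)).sum := by
  induction l with
  | nil => simp [afterFailures, vnorm]
  | cons B l ih =>
    rw [List.map_cons, List.sum_cons, add_comm, afterFailures]
    have hl' : ∀ C ∈ l, Cᴴ * C = 1 ∧ C * Cᴴ = 1 := fun C hC => hl C (List.mem_cons_of_mem _ hC)
    obtain ⟨hB, hB'⟩ := hl B List.mem_cons_self
    -- The comparison vector skips the first test. The later tests are contractions and do not
    -- enlarge its deviation, so every amplitude in the bound refers to the undisturbed `v`.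
    refine (vnorm_sub_le_add _ (afterFailures U T l v) _).trans (add_le_add (ih hl') ?_)
    refine (vnorm_afterFailures_sub_le hT hTT hU (fun C hC => (hl' C hC).1) _ _).trans (le_of_eq ?_)
    have hBU : (B * U)ᴴ * (B * U) = 1 := by
      rw [Matrix.conjTranspose_mul, mul_assoc, ← mul_assoc Bᴴ, hB, one_mul, hU]
    have hBU' : B * U * (B * U)ᴴ = 1 := by
      rw [Matrix.conjTranspose_mul, mul_assoc, ← mul_assoc U, hU', one_mul, hB']
    rw [← vnorm_mulVec_of_isometry hBU (v := (T * (B * U)ᴴ) *ᵥ v), Matrix.mulVec_mulVec]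
    congr 1
    rw [failStep, mul_sub, sub_mul, mul_one, hBU', Matrix.sub_mulVec, Matrix.one_mulVec,
      sub_sub_cancel, mul_assoc]

/-- The overlap of the state of the branch that tests the right logical error `P` with the
original state. -/
theorem le_norm_dotProduct_output {U T : Matrix ι ι ℂ} (hT : Tᴴ = T) (hTT : T * T = T)
    (hU : Uᴴ * U = 1) (hU' : U * Uᴴ = 1) {l : List (Matrix ι ι ℂ)}
    (hl : ∀ B ∈ l, Bᴴ * B = 1 ∧ B * Bᴴ = 1) {P : Matrix ι ι ℂ} (hP : Pᴴ * P = 1) {φ : ι → ℂ}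
    (hφ : star φ ⬝ᵥ φ = 1) (hTφ : T *ᵥ φ = φ) :
    1 - (l.map fun B => vnorm ((T * (B * U)ᴴ) *ᵥ ((P * U) *ᵥ φ))).sum ≤
      ‖star φ ⬝ᵥ ((T * (P * U)ᴴ) *ᵥ afterFailures U T l ((P * U) *ᵥ φ))‖ := by
  have hPU : (P * U)ᴴ * (P * U) = 1 := by
    rw [Matrix.conjTranspose_mul, mul_assoc, ← mul_assoc Pᴴ, hP, one_mul, hU]
  set v := (P * U) *ᵥ φ with hv
  have hvv : star v ⬝ᵥ v = 1 := by
    rw [hv, mulVec_dotProduct_mulVec, hPU, Matrix.one_mulVec, hφ]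
  -- As `T φ = φ` and `v = P U φ`, the overlap with `φ` after the last test equals the overlap with
  -- `v` before it.
  have h1 : star φ ⬝ᵥ ((T * (P * U)ᴴ) *ᵥ afterFailures U T l v) =
      1 - star v ⬝ᵥ (v - afterFailures U T l v) := by
    rw [dotProduct_sub, hvv, sub_sub_cancel]
    have := mulVec_dotProduct_mulVec T ((P * U)ᴴ) φ (afterFailures U T l v)
    rw [hTφ, hT] at this
    rw [← this, hv]
    have := mulVec_dotProduct_mulVec (P * U) 1 φ (afterFailures U T l v)
    rw [Matrix.one_mulVec, mul_one] at this
    exact this.symm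
  rw [h1]
  have h2 := norm_star_dotProduct_le v (v - afterFailures U T l v)
  rw [vnorm_eq_one hvv, one_mul] at h2
  have h3 := vnorm_sub_afterFailures_le hT hTT hU hU' hl v
  have h4 := norm_sub_norm_le (1 : ℂ) (star v ⬝ᵥ (v - afterFailures U T l v))
  rw [norm_one] at h4
  linarith

theorem vnorm_output_le_one {U T : Matrix ι ι ℂ} (hT : Tᴴ = T) (hTT : T * T = T)
    (hU : Uᴴ * U = 1) (hU' : U * Uᴴ = 1) {l : List (Matrix ι ι ℂ)}
    (hl : ∀ B ∈ l, Bᴴ * B = 1 ∧ B * Bᴴ = 1) {P : Matrix ι ι ℂ} (hP : Pᴴ * P = 1 ∧ P * Pᴴ = 1)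
    {φ : ι → ℂ} (hφ : star φ ⬝ᵥ φ = 1) :
    vnorm ((T * (P * U)ᴴ) *ᵥ afterFailures U T l ((P * U) *ᵥ φ)) ≤ 1 := by
  have hPU : (P * U)ᴴ * (P * U) = 1 := by
    rw [Matrix.conjTranspose_mul, mul_assoc, ← mul_assoc Pᴴ, hP.1, one_mul, hU]
  have hPU' : ((P * U)ᴴ)ᴴ * (P * U)ᴴ = 1 := by
    rw [Matrix.conjTranspose_conjTranspose, Matrix.conjTranspose_mul, mul_assoc, ← mul_assoc U, hU',
      one_mul, hP.2]
  rw [← Matrix.mulVec_mulVec]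
  refine (vnorm_mulVec_le_of_proj hT hTT _).trans ?_
  rw [vnorm_mulVec_of_isometry hPU']
  refine (vnorm_afterFailures_le hT hTT hU (fun B hB => (hl B hB).1) _).trans ?_
  rw [vnorm_mulVec_of_isometry hPU, vnorm_eq_one hφ]

/-! ### Fidelity with a pure state -/

theorem sqrt_smul_pureState {φ : ι → ℂ} (hφ : star φ ⬝ᵥ φ = 1) {a : ℝ} (ha : 0 ≤ a) :
    CFC.sqrt (((a ^ 2 : ℝ) : ℂ) • pureState φ) = (a : ℂ) • pureState φ := by
  refine CFC.sqrt_unique ?_ ?_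
  · rw [smul_mul_smul_comm, pureState, Matrix.vecMulVec_mul_vecMulVec, hφ]
    simp [sq]
  · rw [Matrix.nonneg_iff_posSemidef]
    exact (posSemidef_pureState φ).smul (by exact_mod_cast ha)

theorem fidelity_pureState {φ : ι → ℂ} (hφ : star φ ⬝ᵥ φ = 1) (w : ι → ℂ) :
    fidelity ((pureState w).trace⁻¹ • pureState w) (pureState φ) =
      (‖star φ ⬝ᵥ w‖ / vnorm w) ^ 2 := by
  have h1 : CFC.sqrt (pureState φ) = pureState φ := by
    simpa using sqrt_smul_pureState hφ zero_le_one
  have h2 : pureState φ * ((pureState w).trace⁻¹ • pureState w) * pureState φ =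
      (((‖star φ ⬝ᵥ w‖ / vnorm w) ^ 2 : ℝ) : ℂ) • pureState φ := by
    have h3 : (pureState φ)ᴴ = pureState φ := (posSemidef_pureState φ).1
    have h4 : pureState φ *ᵥ w = (star φ ⬝ᵥ w) • φ := by
      rw [pureState, Matrix.vecMulVec_mulVec]
      ext
      simp [mul_comm]
    rw [mul_smul_comm, smul_mul_assoc]
    nth_rewrite 2 [← h3]
    rw [mul_pureState_mul, h4, pureState_smul, trace_pureState, smul_smul]
    congr 1
    have h5 := Complex.conj_mul' (star φ ⬝ᵥ w)
    rw [starRingEnd_apply] at h5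
    rw [h5]
    push_cast
    rw [div_pow, div_eq_mul_inv, mul_comm]
  rw [fidelity, h1, h2, sqrt_smul_pureState hφ (by have := vnorm_nonneg w; positivity),
    Matrix.trace_smul, trace_pureState, vnorm_eq_one hφ]
  simp

end SearchLoop

/-! ### Tagged states -/

section Tag

variable {n : ℕ} (m : ℕ)

theorem tagProj_conjTranspose : (tagProj n m)ᴴ = tagProj n m := by
  rw [tagProj, Matrix.diagonal_conjTranspose]
  congr 1
  funext a
  simp only [Pi.star_apply]
  split_ifs <;> simp

theorem tagProj_mul_self : tagProj n m * tagProj n m = tagProj n m := by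
  rw [tagProj, Matrix.diagonal_mul_diagonal]
  congr 1
  funext a
  split_ifs <;> simp

theorem tagProj_mulVec_addTag (φ : Qubits n → ℂ) : tagProj n m *ᵥ addTag m φ = addTag m φ := by
  funext a
  rw [tagProj, Matrix.mulVec_diagonal, addTag]
  split_ifs <;> simp

theorem sum_ite_tag (f : Qubits n → ℂ) :
    ∑ a : Qubits (n + m), (if (fun j => a (Fin.natAdd n j)) = zeroLabel m then
      f (fun i => a (Fin.castAdd m i)) else 0) = ∑ b, f b := by
  rw [← (Fin.appendEquiv n m).sum_comp, Fintype.sum_prod_type]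
  simp [Fin.appendEquiv]

theorem trace_tagProj : (tagProj n m).trace = 2 ^ n := by
  rw [tagProj, Matrix.trace_diagonal]
  have := sum_ite_tag (n := n) m fun _ => 1
  rw [this]
  simp

theorem dotProduct_addTag (φ : Qubits n → ℂ) :
    star (addTag m φ) ⬝ᵥ addTag m φ = star φ ⬝ᵥ φ := by
  have := sum_ite_tag m fun b => star (φ b) * φ b
  simp only [dotProduct, Pi.star_apply, addTag]
  rw [← this]
  refine Finset.sum_congr rfl fun a _ => ?_
  split_ifs <;> simp

end Tag

/-! ### Correctness of the algorithm for a fixed size -/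

/-- Markov's inequality for a uniformly random key. -/
theorem one_sub_div_le_keyProb {K : Type} [Fintype K] [Nonempty K] {f : K → ℝ} (hf : ∀ x, 0 ≤ f x)
    {a t : ℝ} (ht : 0 < t) (ha : ∑ x, f x ≤ Fintype.card K * a) {p : K → Prop}
    (hp : ∀ x, f x ≤ t → p x) : 1 - a / t ≤ keyProb K p := by
  classical
  have hK : (0 : ℝ) < Fintype.card K := by exact_mod_cast Fintype.card_pos
  rw [keyProb, Nat.card_eq_fintype_card, Nat.card_eq_fintype_card, Fintype.card_subtype,
    le_div_iff₀ hK]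
  have h1 : (Fintype.card K : ℝ) - (Finset.univ.filter p).card =
      (Finset.univ.filter fun x => ¬ p x).card := by
    rw [← Finset.card_univ, ← Finset.card_filter_add_card_filter_not (s := Finset.univ) p]
    push_cast
    ring
  have h2 : t * (Finset.univ.filter fun x => ¬ p x).card ≤ Fintype.card K * a := by
    refine le_trans ?_ ha
    calc t * (Finset.univ.filter fun x => ¬ p x).card
        = ∑ x ∈ Finset.univ.filter fun x => ¬ p x, t := by
          rw [Finset.sum_const, nsmul_eq_mul, mul_comm]
      _ ≤ ∑ x ∈ Finset.univ.filter fun x => ¬ p x, f x := by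
          refine Finset.sum_le_sum fun x hx => ?_
          by_contra! hlt
          exact (Finset.mem_filter.mp hx).2 (hp x hlt.le)
      _ ≤ ∑ x, f x := Finset.sum_le_sum_of_subset_of_nonneg (Finset.filter_subset _ _)
          fun x _ _ => hf x
  rw [← h1] at h2
  have h3 : (Fintype.card K : ℝ) - (Finset.univ.filter p).card ≤ Fintype.card K * a / t := by
    rw [le_div_iff₀ ht]
    linarith
  have h4 : (1 - a / t) * Fintype.card K = Fintype.card K - Fintype.card K * a / t := by ring
  rw [h4]
  linarith

/-- Termwise `x ≤ (x²/d + d)/2`. This replaces Cauchy–Schwarz: with sum of squares at most `L d²`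
and length at most `L` it gives `L d`. -/
theorem list_sum_le_of_sum_sq_le {α : Type} (x : α → ℝ) {d : ℝ} (hd : 0 < d) (l : List α) :
    (l.map x).sum ≤ ((l.map fun b => x b ^ 2).sum / d + l.length * d) / 2 := by
  induction l with
  | nil => simp
  | cons b l ih =>
    simp only [List.map_cons, List.sum_cons, List.length_cons]
    have h : x b ≤ (x b ^ 2 / d + d) / 2 := by
      rw [le_div_iff₀ two_pos, ← sub_nonneg]
      have : x b ^ 2 / d + d - x b * 2 = (x b - d) ^ 2 / d := by
        field_simp
        ring
      rw [this]
      positivity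
    push_cast
    rw [add_div (x b ^ 2), add_mul]
    linarith

section Algorithm

variable {N n m : ℕ} {Q : StabilizerCode N (n + m)}
  {C : Matrix (Qubits N) (Qubits (n + m) × Qubits (N - (n + m))) ℂ}

open Classical in
/-- If the sum of the square roots of the probabilities that a test of a wrong logical error
succeeds is at most `β`, then the algorithm succeeds. -/
theorem le_successProb {dec : Q.Syndrome → List (Matrix (Qubits (n + m)) (Qubits (n + m)) ℂ)}
    {s : Q.Syndrome} {l₁ l₂ : List (Matrix (Qubits (n + m)) (Qubits (n + m)) ℂ)}
    {P : Matrix (Qubits (n + m)) (Qubits (n + m)) ℂ} (hdec : dec s = l₁ ++ P :: l₂)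
    (hP : IsPauli P) (hl₁ : ∀ B ∈ l₁, IsPauli B) {U : Matrix (Qubits (n + m)) (Qubits (n + m)) ℂ}
    (hU : Uᴴ * U = 1) (hU' : U * Uᴴ = 1) {φ : Qubits n → ℂ} (hφ : star φ ⬝ᵥ φ = 1)
    {ρ : Matrix (Qubits N) (Qubits N) ℂ}
    (hρ : ∀ t, StabilizerCode.unencode C (Q.syndromeProj t * ρ * Q.syndromeProj t) =
      if t = s then pureState (P *ᵥ (U *ᵥ addTag m φ)) else 0) {β : ℝ}
    (hβ : (l₁.map fun B =>
      vnorm ((tagProj n m * (B * U)ᴴ) *ᵥ ((P * U) *ᵥ addTag m φ))).sum ≤ β) :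
    1 - 2 * β ≤ successProb Q C dec U ρ (pureState (addTag m φ)) (1 - 2 * β) := by
  set f : Matrix (Qubits (n + m)) (Qubits (n + m)) ℂ → ℝ := fun ω =>
    if 1 - 2 * β ≤ fidelity (ω.trace⁻¹ • ω) (pureState (addTag m φ)) then ω.trace.re else 0 with hf
  have hT := tagProj_conjTranspose (n := n) m
  have hTT := tagProj_mul_self (n := n) m
  have hφ' : star (addTag m φ) ⬝ᵥ addTag m φ = 1 := by rw [dotProduct_addTag, hφ]
  have htr : ∀ w : Qubits (n + m) → ℂ, (pureState w).trace.re = vnorm w ^ 2 := fun w => by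
    rw [trace_pureState, Complex.ofReal_re]
  have hf0 : ∀ w, 0 ≤ f (pureState w) := by
    intro w
    simp only [hf, htr]
    split_ifs
    · positivity
    · exact le_rfl
  have hrun : ∀ t, ∃ v, runAlgorithm Q C dec U ρ t =
      searchLoop U (tagProj n m) (dec t) (pureState v) ∧
        (t = s → v = (P * U) *ᵥ addTag m φ) := by
    intro t
    by_cases hts : t = s
    · exact ⟨_, by rw [runAlgorithm, hρ, if_pos hts], fun _ => Matrix.mulVec_mulVec _ _ _⟩
    · refine ⟨0, ?_, fun h => absurd h hts⟩
      rw [runAlgorithm, hρ, if_neg hts]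
      congr 1
      ext a b
      simp [pureState, Matrix.vecMulVec_apply]
  have hnonneg : ∀ t, 0 ≤ ((runAlgorithm Q C dec U ρ t).map f).sum := by
    intro t
    obtain ⟨v, hv, -⟩ := hrun t
    rw [hv]
    exact sum_map_searchLoop_nonneg hT hf0 _ _
  rw [successProb]
  refine le_trans ?_ (Finset.single_le_sum (fun t _ => hnonneg t) (Finset.mem_univ s))
  -- A nonpositive bound is trivial; otherwise `β < 1/2` makes the output vector nonzero, so it can
  -- be normalised.
  rcases le_or_gt (1 - 2 * β) 0 with hneg | hpos
  · exact hneg.trans (hnonneg s)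
  obtain ⟨v, hv, hvs⟩ := hrun s
  rw [hv, hvs rfl, hdec]
  refine le_trans ?_ (le_sum_map_searchLoop hT hf0 l₁ P l₂ _)
  have hl : ∀ B ∈ l₁, Bᴴ * B = 1 ∧ B * Bᴴ = 1 := fun B hB =>
    ⟨(hl₁ B hB).conjTranspose_mul_self, (hl₁ B hB).mul_conjTranspose_self⟩
  have hover := le_norm_dotProduct_output hT hTT hU hU' hl hP.conjTranspose_mul_self hφ'
    (tagProj_mulVec_addTag m φ)
  have hone := vnorm_output_le_one hT hTT hU hU' hl
    ⟨hP.conjTranspose_mul_self, hP.mul_conjTranspose_self⟩ hφ'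
  set w := (tagProj n m * (P * U)ᴴ) *ᵥ
    afterFailures U (tagProj n m) l₁ ((P * U) *ᵥ addTag m φ) with hw
  have hw0 := vnorm_nonneg w
  have hle := norm_star_dotProduct_le (addTag m φ) w
  rw [vnorm_eq_one hφ', one_mul] at hle
  have hβ0 : 0 ≤ β := hβ.trans' <| List.sum_nonneg fun x hx => by
    obtain ⟨B, -, rfl⟩ := List.mem_map.mp hx
    exact vnorm_nonneg _
  have hoverβ : 1 - β ≤ ‖star (addTag m φ) ⬝ᵥ w‖ := by linarith
  have hwpos : 0 < vnorm w := by linarith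
  have hfid : 1 - 2 * β ≤ fidelity ((pureState w).trace⁻¹ • pureState w)
      (pureState (addTag m φ)) := by
    rw [fidelity_pureState hφ']
    -- Normalising a vector of norm at most one can only increase the overlap.
    have h1 : 1 - β ≤ ‖star (addTag m φ) ⬝ᵥ w‖ / vnorm w := by
      rw [le_div_iff₀ hwpos]
      nlinarith
    nlinarith
  simp only [hf, if_pos hfid, htr]
  nlinarith

/-- The algorithm succeeds for most keys. -/
theorem le_keyProb_successProb (hC : Q.IsCliffordEncoder C)
    {ℰ : Set (Matrix (Qubits N) (Qubits N) ℂ)} (hℰ : ∀ E ∈ ℰ, IsPauli E) {L : ℕ}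
    (hL : Q.IsListDecodable ℰ L)
    {dec : Q.Syndrome → List (Matrix (Qubits (n + m)) (Qubits (n + m)) ℂ)}
    (hdec : Q.IsListDecoder C ℰ dec) {K : Type} [Fintype K] [Nonempty K]
    {U : K → Matrix.unitaryGroup (Qubits (n + m)) ℂ} (hU : IsExactDesign 2 U)
    {φ : Qubits n → ℂ} (hφ : star φ ⬝ᵥ φ = 1) {E : Matrix (Qubits N) (Qubits N) ℂ} (hE : E ∈ ℰ)
    {δ : ℝ} (hδ : 0 < δ) :
    1 - 2 * (2 : ℝ) ^ (-(m : ℝ)) / δ ≤ keyProb K fun key =>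
      1 - 2 * (L * √δ) ≤ successProb Q C dec (U key)
        (E * pureState (StabilizerCode.encode C
          ((U key : Matrix (Qubits (n + m)) (Qubits (n + m)) ℂ) *ᵥ addTag m φ)) * Eᴴ)
        (pureState (addTag m φ)) (1 - 2 * (L * √δ)) := by
  obtain ⟨s, l₁, P, l₂, hs, hlen, hP, hl₁, hρ⟩ := hdec.exists_split hC hℰ hL hE
  have hL0 : (0 : ℝ) < L := by exact_mod_cast hlen.trans_le' (Nat.zero_le _)
  have hlen' : (l₁.length : ℝ) ≤ L := by exact_mod_cast hlen.le
  have hT := tagProj_conjTranspose (n := n) m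
  have hTT := tagProj_mul_self (n := n) m
  have hφ' : star (addTag m φ) ⬝ᵥ addTag m φ = 1 := by rw [dotProduct_addTag, hφ]
  have hX : ∀ B key, (overlap (pureState (addTag m φ)) (tagProj n m) (Bᴴ * P)
      (U key : Matrix (Qubits (n + m)) (Qubits (n + m)) ℂ)).re =
      vnorm ((tagProj n m * (B * (U key : Matrix (Qubits (n + m)) (Qubits (n + m)) ℂ))ᴴ) *ᵥ
        ((P * (U key : Matrix (Qubits (n + m)) (Qubits (n + m)) ℂ)) *ᵥ addTag m φ)) ^ 2 := by
    intro B key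
    rw [overlap_pureState hT hTT, dotProduct_star_self, Complex.ofReal_re, Matrix.mulVec_mulVec,
      Matrix.conjTranspose_mul]
    simp only [mul_assoc]
  have hsum : ∀ l : List (Matrix (Qubits (n + m)) (Qubits (n + m)) ℂ),
      (∀ B ∈ l, IsPauli B ∧ (Bᴴ * P).trace = 0) →
      ∑ key, (l.map fun B => (overlap (pureState (addTag m φ)) (tagProj n m) (Bᴴ * P)
        (U key : Matrix (Qubits (n + m)) (Qubits (n + m)) ℂ)).re).sum ≤
      Fintype.card K * (l.length * (2 * (2 : ℝ) ^ (-(m : ℝ)))) := by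
    intro l
    induction l with
    | nil => simp
    | cons B l ih =>
      intro h
      simp only [List.map_cons, List.sum_cons, Finset.sum_add_distrib, List.length_cons]
      have h1 := ih fun D hD => h D (List.mem_cons_of_mem _ hD)
      obtain ⟨hB, hBP⟩ := h B List.mem_cons_self
      have h2 := sum_overlap_le_of_isExactDesign hφ' hT hTT (hB.conjTranspose.mul hP) hBP hU
      have h3 : 2 * (tagProj n m).trace.re / 2 ^ (n + m) = 2 * (2 : ℝ) ^ (-(m : ℝ)) := by
        rw [trace_tagProj, show ((2 : ℂ) ^ n) = (((2 : ℝ) ^ n : ℝ) : ℂ) by push_cast; rfl,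
          Complex.ofReal_re, Real.rpow_neg two_pos.le, Real.rpow_natCast, pow_add]
        field_simp
      rw [h3] at h2
      push_cast
      linarith
  -- Markov is applied to the sum over the wrong entries, with mean at most `2 L · 2^(-m)` and
  -- threshold `L δ`. A union bound over entries would lose the factor `L`.
  have hκ : 2 * (2 : ℝ) ^ (-(m : ℝ)) / δ = L * (2 * (2 : ℝ) ^ (-(m : ℝ))) / (L * δ) := by
    field_simp
  rw [hκ]
  refine one_sub_div_le_keyProb (f := fun key => (l₁.map fun B =>
    (overlap (pureState (addTag m φ)) (tagProj n m) (Bᴴ * P)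
      (U key : Matrix (Qubits (n + m)) (Qubits (n + m)) ℂ)).re).sum) ?_ (mul_pos hL0 hδ) ?_ ?_
  · intro key
    refine List.sum_nonneg fun x hx => ?_
    obtain ⟨B, -, rfl⟩ := List.mem_map.mp hx
    exact overlap_pureState_re_nonneg hT hTT _ _
  · refine (hsum l₁ hl₁).trans ?_
    gcongr
  · intro key hkey
    refine le_successProb hs hP (fun B hB => (hl₁ B hB).1)
      (Matrix.mem_unitaryGroup_iff'.mp (U key).2) (Matrix.mem_unitaryGroup_iff.mp (U key).2) hφ
      (hρ _) ?_
    simp only [hX] at hkey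
    have hδ' : 0 < √δ := Real.sqrt_pos.mpr hδ
    -- The choice `d = √δ` balances the two terms; each is at most `L √δ`.
    refine (list_sum_le_of_sum_sq_le _ hδ' l₁).trans ?_
    have h1 : (l₁.length : ℝ) * √δ ≤ L * √δ := by gcongr
    have h2 := div_le_div_of_nonneg_right hkey hδ'.le
    rw [mul_div_assoc, Real.div_sqrt] at h2
    linarith

end Algorithm

/-! ### Asymptotics -/

theorem negligible_of_isBigO {f q : ℕ → ℝ} (hf : ∀ n, 0 ≤ f n) {a : ℝ} (ha : 0 < a) {d : ℕ}
    (hq : SuperLog q) (hfq : f =O[atTop] fun n => (n : ℝ) ^ d * (2 : ℝ) ^ (-(a * q n))) :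
    Negligible f := by
  refine ⟨hf, fun c => ?_⟩
  obtain ⟨C, hC⟩ := hfq.bound
  have hlog2 : 0 < Real.log 2 := Real.log_pos one_lt_two
  have ev : ∀ᶠ n : ℕ in atTop, f n < ((n : ℝ) ^ c)⁻¹ := by
    -- The threshold makes `2^(-a q) ≤ n^(-(d+c+1))`. The power `d` cancels the polynomial factor
    -- and the extra `1` absorbs the constant `C < n`.
    filter_upwards [hC, hq.eventually_ge_atTop ((d + c + 1) / (a * Real.log 2)),
      eventually_gt_atTop 1, eventually_gt_atTop ⌈C⌉₊] with n h1 h2 h3 h4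
    have hn1 : (1 : ℝ) < n := by exact_mod_cast h3
    have hn0 : (0 : ℝ) < n := by linarith
    have hlogn : 0 < Real.log n := Real.log_pos hn1
    have hCn : C < n := (Nat.le_ceil C).trans_lt (by exact_mod_cast h4)
    rw [le_div_iff₀ hlogn, div_mul_eq_mul_div, div_le_iff₀ (mul_pos ha hlog2)] at h2
    have h5 : (2 : ℝ) ^ (-(a * q n)) ≤ ((n : ℝ) ^ (d + c + 1))⁻¹ := by
      rw [Real.rpow_def_of_pos two_pos, ← Real.rpow_natCast, ← Real.rpow_neg hn0.le,
        Real.rpow_def_of_pos hn0, Real.exp_le_exp]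
      push_cast
      linarith
    rw [Real.norm_of_nonneg (hf n), Real.norm_of_nonneg (by positivity)] at h1
    have h6 : (n : ℝ) ^ d * (2 : ℝ) ^ (-(a * q n)) ≤ ((n : ℝ) ^ (c + 1))⁻¹ := by
      calc (n : ℝ) ^ d * (2 : ℝ) ^ (-(a * q n)) ≤ (n : ℝ) ^ d * ((n : ℝ) ^ (d + c + 1))⁻¹ := by
            gcongr
        _ = ((n : ℝ) ^ (c + 1))⁻¹ := by
            rw [add_assoc, pow_add]
            field_simp
    have h7 : 0 < (n : ℝ) ^ d * (2 : ℝ) ^ (-(a * q n)) := by positivity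
    calc f n ≤ C * ((n : ℝ) ^ d * (2 : ℝ) ^ (-(a * q n))) := h1
      _ < n * ((n : ℝ) ^ d * (2 : ℝ) ^ (-(a * q n))) := mul_lt_mul_of_pos_right hCn h7
      _ ≤ n * ((n : ℝ) ^ (c + 1))⁻¹ := by gcongr
      _ = ((n : ℝ) ^ c)⁻¹ := by
          rw [pow_succ]
          field_simp
  obtain ⟨n₀, hn₀⟩ := eventually_atTop.mp ev
  exact ⟨n₀, fun n hn => hn₀ n hn.le⟩

/-- Take `p = min (m/2) (log² n)`: the square of the logarithm keeps it polylogarithmic, and half of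
`m` leaves `m - p ≥ m/2`. -/
theorem exists_polylog_superLog {m : ℕ → ℝ} (hm0 : ∀ n, 0 ≤ m n) (hm : SuperLog m) :
    ∃ p : ℕ → ℝ, Polylog p ∧ SuperLog p ∧ SuperLog fun n => m n - p n := by
  have hlog : Tendsto (fun n : ℕ => Real.log (n : ℝ)) atTop atTop :=
    Real.tendsto_log_atTop.comp tendsto_natCast_atTop_atTop
  have hm2 : Tendsto (fun n : ℕ => m n / 2 / Real.log n) atTop atTop := by
    have : (fun n : ℕ => m n / 2 / Real.log n) = fun n : ℕ => m n / Real.log n / 2 := by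
      funext n
      ring
    rw [this]
    exact hm.atTop_div_const two_pos
  refine ⟨fun n => min (m n / 2) (Real.log n ^ 2), ⟨2, ?_⟩, ?_, ?_⟩
  · refine IsBigO.of_bound 1 (Eventually.of_forall fun n => ?_)
    have h1 : 0 ≤ min (m n / 2) (Real.log n ^ 2) := le_min (by linarith [hm0 n]) (sq_nonneg _)
    rw [Real.norm_of_nonneg h1, Real.norm_of_nonneg (sq_nonneg _), one_mul]
    exact min_le_right _ _
  · refine tendsto_atTop.mpr fun b => ?_
    filter_upwards [hm2.eventually_ge_atTop b, hlog.eventually_ge_atTop b,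
      hlog.eventually_gt_atTop 0] with n h1 h2 h3
    rw [le_div_iff₀ h3] at h1 ⊢
    refine le_min h1 ?_
    rw [sq]
    gcongr
  · refine tendsto_atTop_mono' _ ?_ hm2
    filter_upwards [hlog.eventually_gt_atTop 0] with n h3
    refine div_le_div_of_nonneg_right ?_ h3.le
    linarith [min_le_left (m n / 2) (Real.log n ^ 2)]

/-! ### The main theorem -/

theorem theorem2 (m L : ℕ → ℕ) (ε : ℕ → ℝ)
    (hm : SuperLog fun n => (m n : ℝ))
    (hL : ∃ c : ℕ, (fun n => (L n : ℝ)) =O[atTop] fun n : ℕ => (n : ℝ) ^ c)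
    (hε_nonneg : ∀ n, 0 ≤ ε n)
    (hε : ε =O[atTop] fun n => (2 : ℝ) ^ (-(m n : ℝ))) :
    (∃ p : ℕ → ℝ, Polylog p ∧ SuperLog p ∧ SuperLog fun n => (m n : ℝ) - p n) ∧
    ∀ p δ : ℕ → ℝ, Polylog p → (∀ n, 0 < δ n) →
      (δ =Θ[atTop] fun n => (2 : ℝ) ^ (-(m n : ℝ) + p n)) →
      ∃ η ν κ : ℕ → ℝ,
        (η =Θ[atTop] fun n => (L n : ℝ) * (2 : ℝ) ^ (-(m n : ℝ) / 2 + p n / 2)) ∧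
        (κ =O[atTop] fun n => (ε n + (2 : ℝ) ^ (-(m n : ℝ))) / δ n) ∧
        ((SuperLog fun n => (m n : ℝ) - p n) → Negligible η ∧ Negligible ν) ∧
        (SuperLog p → Negligible κ) ∧
        ∀ (n N : ℕ) (Q : StabilizerCode N (n + m n))
          (C : Matrix (Qubits N) (Qubits (n + m n) × Qubits (N - (n + m n))) ℂ)
          (_ : Q.IsCliffordEncoder C)
          (ℰ : Set (Matrix (Qubits N) (Qubits N) ℂ)) (_ : ∀ E ∈ ℰ, IsPauli E)
          (_ : Q.IsListDecodable ℰ (L n))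
          (dec : Q.Syndrome → List (Matrix (Qubits (n + m n)) (Qubits (n + m n)) ℂ))
          (_ : Q.IsListDecoder C ℰ dec)
          (K : Type) [Fintype K] [Nonempty K]
          (U : K → Matrix.unitaryGroup (Qubits (n + m n)) ℂ)
          (_ : IsExactDesign 2 U) (_ : IsRelativeErrorDesign 4 (ε n) U)
          (φ : Qubits n → ℂ) (_ : star φ ⬝ᵥ φ = 1)
          (E : Matrix (Qubits N) (Qubits N) ℂ) (_ : E ∈ ℰ),
          1 - κ n ≤ keyProb K fun key =>
            1 - ν n ≤ successProb Q C dec (U key)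
              (E * pureState (StabilizerCode.encode C
                ((U key : Matrix (Qubits (n + m n)) (Qubits (n + m n)) ℂ) *ᵥ
                  addTag (m n) φ)) * Eᴴ)
              (pureState (addTag (m n) φ)) (1 - η n) := by
  refine ⟨exists_polylog_superLog (fun n => Nat.cast_nonneg _) hm, fun p δ _ hδ hδΘ => ?_⟩
  have hsqrt : (fun n => √(δ n)) =Θ[atTop] fun n => (2 : ℝ) ^ (-(m n : ℝ) / 2 + p n / 2) := by
    refine (hδΘ.sqrt (Eventually.of_forall fun n => (hδ n).le)
      (Eventually.of_forall fun n => by dsimp only [Pi.zero_apply]; positivity)).trans_eventuallyEq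
      (Eventually.of_forall fun n => ?_)
    dsimp only
    rw [Real.sqrt_eq_rpow, ← Real.rpow_mul two_pos.le]
    congr 1
    ring
  have hη : (fun n => 2 * ((L n : ℝ) * √(δ n))) =Θ[atTop]
      fun n => (L n : ℝ) * (2 : ℝ) ^ (-(m n : ℝ) / 2 + p n / 2) :=
    ((isTheta_refl _ _).mul hsqrt).const_mul_left two_ne_zero
  refine ⟨fun n => 2 * (L n * √(δ n)), fun n => 2 * (L n * √(δ n)),
    fun n => 2 * (2 : ℝ) ^ (-(m n : ℝ)) / δ n, hη, ?_, ?_, ?_, ?_⟩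
  · refine IsBigO.of_bound 2 (Eventually.of_forall fun n => ?_)
    have h2 : (0 : ℝ) < (2 : ℝ) ^ (-(m n : ℝ)) := by positivity
    have h3 := hδ n
    have h4 := hε_nonneg n
    rw [Real.norm_of_nonneg (by positivity), Real.norm_of_nonneg (by positivity), mul_div_assoc]
    gcongr
    linarith
  · intro hmp
    obtain ⟨c, hc⟩ := hL
    have hneg : Negligible fun n => 2 * (L n * √(δ n)) := by
      -- The square root of `δ` halves the exponent `m - p`, and `d = c` is the degree of the
      -- polynomial bound on `L`.
      refine negligible_of_isBigO (a := 1 / 2) (d := c) (fun n => by positivity) (by norm_num) hmp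
        (hη.1.trans ?_)
      refine (hc.mul (isBigO_refl _ _)).congr_right fun n => ?_
      congr 2
      ring
    exact ⟨hneg, hneg⟩
  · intro hp
    refine negligible_of_isBigO (a := 1) (d := 0) (fun n => ?_) one_pos hp ?_
    · have := hδ n
      positivity
    -- The lower half of the `Θ` bound on `δ` leaves `2^(-m) / δ = O(2^(-p))`.
    · have h1 : (fun n => (δ n)⁻¹) =O[atTop] fun n => ((2 : ℝ) ^ (-(m n : ℝ) + p n))⁻¹ :=
        hδΘ.2.inv_rev (Eventually.of_forall fun n h => absurd h (by positivity))
      have h2 := ((isBigO_refl (fun n => (2 : ℝ) ^ (-(m n : ℝ))) atTop).const_mul_left 2).mul h1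
      refine h2.congr (fun n => (div_eq_mul_inv _ _).symm) fun n => ?_
      rw [← Real.rpow_neg two_pos.le, ← Real.rpow_add two_pos, pow_zero, one_mul]
      congr 1
      ring
  · intro n N Q C hC ℰ hℰ hLD dec hdec K _ _ U hU _ φ hφ E hE
    exact le_keyProb_successProb hC hℰ hLD hdec hU hφ hE (hδ n)
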